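/- Let $G$ be a locally compact Hausdorff group with a Haar measure $dx$, let $H$ be a compact subgroup with normalized Haar measure $dh$, and let $m$ be the normalized $G$-invariant Radon measure on $G/H$, i.e. the $G$-invariant Radon measure satisfying Weil's formula $\int_{G/H}\int_H f(xh)\,dh\,dm(xH)=\int_G f(x)\,dx$ for $f\in C_c(G)$. Let $\varphi:\mathbb R\to[0,\infty]$ be a Young function, i.e. convex, even, left continuous on $[0,\infty)$ (at $0$ this means $\varphi(x)\to 0$ as $x\to 0^-$), with $\varphi(0)=0$ and $\lim_{x\to\infty}\varphi(x)=\infty$. Assume that $\varphi$ satisfies the $\Delta_2$-condition: if $m(G/H)<\infty$, there are $C,x_0>0$ with $\varphi(2x)\le C\varphi(x)$ for all $x\ge x_0$; if $m(G/H)=\infty$, there is $C>0$ with $\varphi(2x)\le C\varphi(x)$ for all $x\ge 0$. Let $L^\varphi(G/H,m)$ be the space of (classes of) measurable functions $f:G/H\to\mathbb C$ with $\int\varphi(a|f|)\,dm<\infty$ for some $a>0$, with the Luxemburg norm $\|f\|_\varphi=\inf\{k>0:\int\varphi(|f|/k)\,dm\le 1\}$. For $f,g\in C_c(G/H)$ put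 $Jg(xH)=\int_H g(hxH)\,dh$ and $$ (f*_{G/H}g)(xH)=\int_{G/H} f(yH)\,Jg(y^{-1}xH)\,dm(yH). $$ Then $*_{G/H}$ is a bilinear map $C_c(G/H)\times C_c(G/H)\to C_c(G/H)$. It extends to a bilinear product on $L^1(G/H,m)$ which makes $L^1(G/H,m)$ a Banach algebra (complete, associative, $\|f_1*f_2\|_1\le\|f_1\|_1\|f_2\|_1$), and it extends to a bilinear map $*^\varphi_{G/H}:L^1(G/H,m)\times L^\varphi(G/H,m)\to L^\varphi(G/H,m)$ which makes $L^\varphi(G/H,m)$ a Banach left $L^1(G/H,m)$-module: $L^\varphi(G/H,m)$ is complete, $(f_1*f_2)*^\varphi_{G/H}g=f_1*^\varphi_{G/H}(f_2*^\varphi_{G/H}g)$ and $\|f*^\varphi_{G/H}g\|_\varphi\le\|f\|_1\|g\|_\varphi$ for all $f,f_1,f_2\in L^1(G/H,m)$ and $g\in L^\varphi(G/H,m)$. -/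

import Mathlib

open MeasureTheory Set Filter Topology
open scoped ENNReal NNReal CompactlySupported

/-! ### Young functions -/

/-- A Young function `φ : ℝ → [0, ∞]`: convex, even, left continuous, `φ 0 = 0` and
`φ x → ∞` as `x → ∞` (in particular `φ` is not identically zero).  The value `∞` is allowed.
Left continuity is only required on `[0, ∞)`; at `0` it says that `φ` is finite and small
near `0`, so that the function equal to `∞` off `0` is not a Young function. -/
structure YoungFunction where
  toFun : ℝ → ℝ≥0∞
  convex' : ConvexOn ℝ≥0 Set.univ toFun
  even' : ∀ x, toFun (-x) = toFun x
  leftCont' : ∀ x, 0 ≤ x → ContinuousWithinAt toFun (Set.Iic x) x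
  map_zero' : toFun 0 = 0
  tendsto_top' : Tendsto toFun atTop (𝓝 ∞)

instance : CoeFun YoungFunction (fun _ => ℝ → ℝ≥0∞) := ⟨YoungFunction.toFun⟩

/-- The `Δ₂`-condition relative to a measure `m`: `φ (2x) ≤ C φ x` for all large `x` if the total
mass of `m` is finite, and for all `x ≥ 0` otherwise. -/
def YoungFunction.Delta2 {Ω : Type*} [MeasurableSpace Ω] (φ : YoungFunction) (m : Measure Ω) :
    Prop :=
  (m Set.univ < ∞ →
    ∃ C : ℝ≥0, 0 < C ∧ ∃ x₀ : ℝ, 0 < x₀ ∧ ∀ x, x₀ ≤ x → φ (2 * x) ≤ C * φ x) ∧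
  (m Set.univ = ∞ → ∃ C : ℝ≥0, 0 < C ∧ ∀ x, 0 ≤ x → φ (2 * x) ≤ C * φ x)

namespace YoungFunction

variable (φ : YoungFunction)

theorem map_zero : φ 0 = 0 := φ.map_zero'

theorem convex_le (x y : ℝ) {a b : ℝ} (ha : 0 ≤ a) (hb : 0 ≤ b) (hab : a + b = 1) :
    φ (a * x + b * y) ≤ ENNReal.ofReal a * φ x + ENNReal.ofReal b * φ y := by
  lift a to ℝ≥0 using ha
  lift b to ℝ≥0 using hb
  have h := φ.convex'.2 (mem_univ x) (mem_univ y) (zero_le (a := a)) (zero_le (a := b)) (by exact_mod_cast hab)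
  simpa [NNReal.smul_def, ENNReal.smul_def] using h

theorem map_mul_le {a x : ℝ} (ha : 0 ≤ a) (ha1 : a ≤ 1) :
    φ (a * x) ≤ ENNReal.ofReal a * φ x := by
  have h := φ.convex_le x 0 ha (sub_nonneg.2 ha1) (by ring)
  simpa [φ.map_zero] using h

theorem mono {x y : ℝ} (hx : 0 ≤ x) (hxy : x ≤ y) : φ x ≤ φ y := by
  rcases hx.eq_or_lt with rfl | hx'
  · simp [φ.map_zero]
  have hy : 0 < y := hx'.trans_le hxy
  have h1 : x / y ≤ 1 := (div_le_one hy).2 hxy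
  calc φ x = φ (x / y * y) := by rw [div_mul_cancel₀ _ hy.ne']
    _ ≤ ENNReal.ofReal (x / y) * φ y := φ.map_mul_le (by positivity) h1
    _ ≤ 1 * φ y := by gcongr; exact ENNReal.ofReal_le_one.2 h1
    _ = φ y := one_mul _

/-- Composition of a Young function with the positive part is measurable, since it is monotone. -/
theorem measurable_posPart : Measurable (fun x : ℝ => φ (max x 0)) :=
  Monotone.measurable fun _ _ h => φ.mono (le_max_right _ _) (max_le_max_right _ h)

theorem aemeasurable_comp {Ω : Type*} [MeasurableSpace Ω] {m : Measure Ω} {u : Ω → ℝ}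
    (hu : AEMeasurable u m) (h0 : ∀ x, 0 ≤ u x) : AEMeasurable (fun x => φ (u x)) m := by
  have h := φ.measurable_posPart.comp_aemeasurable hu
  refine h.congr (Eventually.of_forall fun x => ?_)
  simp [max_eq_left (h0 x)]

theorem exists_pos_lt_top : ∃ t : ℝ, 0 < t ∧ φ t < ∞ := by
  have h := φ.leftCont' 0 le_rfl
  have h' : ∀ᶠ x in 𝓝[≤] (0 : ℝ), φ x < ∞ :=
    h.eventually (gt_mem_nhds (show φ 0 < ∞ by simp [φ.map_zero]))
  have h'' : ∀ᶠ x in 𝓝[<] (0 : ℝ), φ x < ∞ :=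
    nhdsWithin_mono _ Iio_subset_Iic_self h'
  obtain ⟨x, hx, hx0⟩ := (h''.and self_mem_nhdsWithin).exists
  refine ⟨-x, neg_pos.2 hx0, ?_⟩
  rw [show φ (-x) = φ x from φ.even' x]
  exact hx

end YoungFunction

/-! ### Orlicz spaces and the Luxemburg norm -/

section Orlicz

variable {Ω : Type*} [MeasurableSpace Ω]

/-- The modular `ρ_φ(u) = ∫ φ(|u|) dm`. -/
noncomputable def orliczModular (φ : YoungFunction) (m : Measure Ω) (u : Ω → ℂ) : ℝ≥0∞ :=
  ∫⁻ x, φ ‖u x‖ ∂m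

/-- The Luxemburg (gauge) norm `inf {k > 0 : ∫ φ(|u| / k) dm ≤ 1}`. -/
noncomputable def luxemburgNorm (φ : YoungFunction) (m : Measure Ω) (u : Ω → ℂ) : ℝ :=
  sInf {k : ℝ | 0 < k ∧ ∫⁻ x, φ (‖u x‖ / k) ∂m ≤ 1}

theorem luxemburgNorm_congr (φ : YoungFunction) {m : Measure Ω} {u v : Ω → ℂ} (h : u =ᵐ[m] v) :
    luxemburgNorm φ m u = luxemburgNorm φ m v := by
  unfold luxemburgNorm
  congr 1
  ext k
  have : ∫⁻ x, φ (‖u x‖ / k) ∂m = ∫⁻ x, φ (‖v x‖ / k) ∂m :=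
    lintegral_congr_ae (h.mono fun x hx => by simp only [hx])
  simp only [mem_ofPred_eq, this]

theorem orliczModular_congr (φ : YoungFunction) {m : Measure Ω} {u v : Ω → ℂ} (h : u =ᵐ[m] v) :
    orliczModular φ m u = orliczModular φ m v :=
  lintegral_congr_ae (h.mono fun x hx => by simp only [hx])

theorem orlicz_lintegral_convex_le (φ : YoungFunction) {m : Measure Ω} {u v : Ω → ℂ}
    (hu : AEStronglyMeasurable u m) {a b s t : ℝ} (ha : 0 ≤ a) (hb : 0 ≤ b) (hab : a + b = 1)
    (hs : 0 ≤ s) (w : Ω → ℝ) (hw0 : ∀ x, 0 ≤ w x)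
    (hw : ∀ᵐ x ∂m, w x ≤ a * (s * ‖u x‖) + b * (t * ‖v x‖)) :
    ∫⁻ x, φ (w x) ∂m ≤ ENNReal.ofReal a * ∫⁻ x, φ (s * ‖u x‖) ∂m
      + ENNReal.ofReal b * ∫⁻ x, φ (t * ‖v x‖) ∂m := by
  have hm : AEMeasurable (fun x => φ (s * ‖u x‖)) m :=
    φ.aemeasurable_comp (hu.norm.aemeasurable.const_mul s) fun x => by positivity
  calc ∫⁻ x, φ (w x) ∂m
      ≤ ∫⁻ x, (ENNReal.ofReal a * φ (s * ‖u x‖) + ENNReal.ofReal b * φ (t * ‖v x‖)) ∂m :=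
        lintegral_mono_ae (hw.mono fun x hx =>
          (φ.mono (hw0 x) hx).trans (φ.convex_le _ _ ha hb hab))
    _ = _ := by
        rw [lintegral_add_left' (hm.const_mul _), lintegral_const_mul'' _ hm,
          lintegral_const_mul' _ _ ENNReal.ofReal_ne_top]

/-- The Orlicz space `L^φ(Ω, m)`: classes of `m`-measurable complex functions `f` with
`ρ_φ(a f) < ∞` for some `a > 0`. -/
def OrliczSpace (φ : YoungFunction) (m : Measure Ω) : Submodule ℂ (Ω →ₘ[m] ℂ) where
  carrier := {f | ∃ a : ℝ, 0 < a ∧ orliczModular φ m (fun x => (a : ℂ) * f x) < ∞}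
  zero_mem' := by
    refine ⟨1, one_pos, ?_⟩
    have h : orliczModular φ m (fun x => ((1 : ℝ) : ℂ) * (0 : Ω →ₘ[m] ℂ) x)
        = orliczModular φ m (fun _ => 0) :=
      orliczModular_congr φ ((AEEqFun.coeFn_zero (μ := m) (β := ℂ)).mono fun x hx => by simp [hx])
    rw [h]
    simp [orliczModular, φ.map_zero]
  add_mem' := by
    rintro f g ⟨a, ha, hf⟩ ⟨b, hb, hg⟩
    have e : ∀ (c : ℝ) (hc : 0 < c) (u : Ω → ℂ), orliczModular φ m (fun x => (c : ℂ) * u x)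
        = ∫⁻ x, φ (c * ‖u x‖) ∂m := fun c hc u => by
      simp [orliczModular, abs_of_pos hc]
    have hc : 0 < min a b / 2 := by positivity
    refine ⟨min a b / 2, hc, ?_⟩
    rw [e _ ha] at hf
    rw [e _ hb] at hg
    rw [e _ hc]
    refine lt_of_le_of_lt (orlicz_lintegral_convex_le φ (u := f) (v := g) (a := 1 / 2) (b := 1 / 2)
      (s := a) (t := b) f.aestronglyMeasurable (by norm_num) (by norm_num) (by norm_num) ha.le _
      (fun x => by positivity) ?_) ?_
    · filter_upwards [AEEqFun.coeFn_add f g] with x hx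
      rw [hx, Pi.add_apply]
      have h1 := norm_add_le (f x) (g x)
      have h2 : min a b * ‖f x‖ ≤ a * ‖f x‖ := by gcongr; exact min_le_left _ _
      have h3 : min a b * ‖g x‖ ≤ b * ‖g x‖ := by gcongr; exact min_le_right _ _
      have h4 := mul_le_mul_of_nonneg_left h1 hc.le
      linarith
    · exact ENNReal.add_lt_top.2
        ⟨ENNReal.mul_lt_top ENNReal.ofReal_lt_top hf, ENNReal.mul_lt_top ENNReal.ofReal_lt_top hg⟩
  smul_mem' := by
    rintro c f ⟨a, ha, hf⟩
    have hpos : 0 < ‖c‖ + 1 := by positivity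
    refine ⟨a / (‖c‖ + 1), by positivity, lt_of_le_of_lt ?_ hf⟩
    refine lintegral_mono_ae ?_
    filter_upwards [AEEqFun.coeFn_smul c f] with x hx
    refine φ.mono (norm_nonneg _) ?_
    rw [hx, Pi.smul_apply, smul_eq_mul, norm_mul, norm_mul, norm_mul, Complex.norm_real,
      Complex.norm_real, Real.norm_of_nonneg ha.le, Real.norm_of_nonneg (by positivity)]
    have h1 : ‖c‖ / (‖c‖ + 1) ≤ 1 := (div_le_one hpos).2 (by linarith)
    calc a / (‖c‖ + 1) * (‖c‖ * ‖f x‖) = (‖c‖ / (‖c‖ + 1)) * (a * ‖f x‖) := by ring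
      _ ≤ 1 * (a * ‖f x‖) := by gcongr
      _ = a * ‖f x‖ := one_mul _

variable (φ : YoungFunction) (m : Measure Ω)

theorem luxemburg_bddBelow (u : Ω → ℂ) :
    BddBelow {k : ℝ | 0 < k ∧ ∫⁻ x, φ (‖u x‖ / k) ∂m ≤ 1} :=
  ⟨0, fun _ hk => hk.1.le⟩

theorem luxemburgNorm_nonneg (u : Ω → ℂ) : 0 ≤ luxemburgNorm φ m u :=
  Real.sInf_nonneg fun _ hk => hk.1.le

variable {m}

theorem luxemburg_nonempty (f : OrliczSpace φ m) :
    {k : ℝ | 0 < k ∧ ∫⁻ x, φ (‖(f : Ω →ₘ[m] ℂ) x‖ / k) ∂m ≤ 1}.Nonempty := by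
  obtain ⟨a, ha, hf⟩ := f.2
  set M := orliczModular φ m (fun x => (a : ℂ) * (f : Ω →ₘ[m] ℂ) x) with hM
  have hc : 0 < M.toReal + 1 := by positivity
  refine ⟨(M.toReal + 1) / a, by positivity, ?_⟩
  calc ∫⁻ x, φ (‖(f : Ω →ₘ[m] ℂ) x‖ / ((M.toReal + 1) / a)) ∂m
      ≤ ∫⁻ x, ENNReal.ofReal (M.toReal + 1)⁻¹ * φ ‖(a : ℂ) * (f : Ω →ₘ[m] ℂ) x‖ ∂m := by
        refine lintegral_mono fun x => ?_
        have : ‖(f : Ω →ₘ[m] ℂ) x‖ / ((M.toReal + 1) / a)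
            = (M.toReal + 1)⁻¹ * ‖(a : ℂ) * (f : Ω →ₘ[m] ℂ) x‖ := by
          rw [norm_mul, Complex.norm_real, Real.norm_of_nonneg ha.le]
          field_simp
        rw [this]
        exact φ.map_mul_le (by positivity) (inv_le_one_of_one_le₀ (by simp))
    _ = ENNReal.ofReal (M.toReal + 1)⁻¹ * M := by
        rw [lintegral_const_mul' _ _ ENNReal.ofReal_ne_top, hM, orliczModular]
    _ = ENNReal.ofReal ((M.toReal + 1)⁻¹ * M.toReal) := by
        rw [ENNReal.ofReal_mul (by positivity), ENNReal.ofReal_toReal hf.ne]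
    _ ≤ 1 := by
        refine ENNReal.ofReal_le_one.2 ?_
        rw [inv_mul_le_iff₀ hc]
        linarith

theorem luxemburgNorm_add_le (f g : OrliczSpace φ m) :
    luxemburgNorm φ m ((f + g : OrliczSpace φ m) : Ω →ₘ[m] ℂ)
      ≤ luxemburgNorm φ m (f : Ω →ₘ[m] ℂ) + luxemburgNorm φ m (g : Ω →ₘ[m] ℂ) := by
  refine le_of_forall_pos_le_add fun ε hε => ?_
  obtain ⟨k, ⟨hk, hk1⟩, hkε⟩ := Real.lt_sInf_add_pos (luxemburg_nonempty φ f) (half_pos hε)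
  obtain ⟨l, ⟨hl, hl1⟩, hlε⟩ := Real.lt_sInf_add_pos (luxemburg_nonempty φ g) (half_pos hε)
  have hmem : luxemburgNorm φ m ((f + g : OrliczSpace φ m) : Ω →ₘ[m] ℂ) ≤ k + l := by
    refine csInf_le (luxemburg_bddBelow φ m _) ⟨by positivity, ?_⟩
    have e : ∀ (c : ℝ) (u : Ω → ℂ), ∫⁻ x, φ (c⁻¹ * ‖u x‖) ∂m = ∫⁻ x, φ (‖u x‖ / c) ∂m :=
      fun c u => by simp only [inv_mul_eq_div]
    refine (orlicz_lintegral_convex_le φ (u := (f : Ω →ₘ[m] ℂ)) (v := (g : Ω →ₘ[m] ℂ))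
      (a := k / (k + l)) (b := l / (k + l)) (s := k⁻¹) (t := l⁻¹)
      (f : Ω →ₘ[m] ℂ).aestronglyMeasurable (by positivity) (by positivity)
      (by field_simp) (by positivity) _ (fun x => by positivity) ?_).trans ?_
    · filter_upwards [AEEqFun.coeFn_add (f : Ω →ₘ[m] ℂ) (g : Ω →ₘ[m] ℂ)] with x hx
      rw [Submodule.coe_add, hx, Pi.add_apply]
      have h1 := norm_add_le ((f : Ω →ₘ[m] ℂ) x) ((g : Ω →ₘ[m] ℂ) x)
      calc _ ≤ (‖(f : Ω →ₘ[m] ℂ) x‖ + ‖(g : Ω →ₘ[m] ℂ) x‖) / (k + l) := by gcongr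
        _ = _ := by field_simp
    · rw [e, e]
      calc _ ≤ ENNReal.ofReal (k / (k + l)) * 1 + ENNReal.ofReal (l / (k + l)) * 1 := by gcongr
        _ = 1 := by
          rw [mul_one, mul_one, ← ENNReal.ofReal_add (by positivity) (by positivity), ← add_div,
            div_self (by positivity), ENNReal.ofReal_one]
  have h1 : k < luxemburgNorm φ m (f : Ω →ₘ[m] ℂ) + ε / 2 := hkε
  have h2 : l < luxemburgNorm φ m (g : Ω →ₘ[m] ℂ) + ε / 2 := hlε
  linarith

theorem luxemburgNorm_zero : luxemburgNorm φ m (fun _ => 0) = 0 := by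
  refine le_antisymm (le_of_forall_pos_le_add fun ε hε => ?_) (luxemburgNorm_nonneg φ m _)
  rw [zero_add]
  exact csInf_le (luxemburg_bddBelow φ m _) ⟨hε, by simp [φ.map_zero]⟩

theorem luxemburgNorm_smul_le {c : ℂ} (hc : c ≠ 0) (f : OrliczSpace φ m) :
    luxemburgNorm φ m ((c • f : OrliczSpace φ m) : Ω →ₘ[m] ℂ)
      ≤ ‖c‖ * luxemburgNorm φ m (f : Ω →ₘ[m] ℂ) := by
  have hc' : 0 < ‖c‖ := norm_pos_iff.2 hc
  rw [← div_le_iff₀' hc']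
  refine le_csInf (luxemburg_nonempty φ f) fun k hk => ?_
  rw [div_le_iff₀' hc']
  refine csInf_le (luxemburg_bddBelow φ m _) ⟨mul_pos hc' hk.1, le_trans (le_of_eq ?_) hk.2⟩
  refine lintegral_congr_ae ?_
  filter_upwards [AEEqFun.coeFn_smul c (f : Ω →ₘ[m] ℂ)] with x hx
  rw [Submodule.coe_smul, hx, Pi.smul_apply, norm_smul, mul_div_mul_left _ _ hc'.ne']

theorem luxemburgNorm_smul (c : ℂ) (f : OrliczSpace φ m) :
    luxemburgNorm φ m ((c • f : OrliczSpace φ m) : Ω →ₘ[m] ℂ)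
      = ‖c‖ * luxemburgNorm φ m (f : Ω →ₘ[m] ℂ) := by
  rcases eq_or_ne c 0 with rfl | hc
  · rw [zero_smul, norm_zero, zero_mul, ← luxemburgNorm_zero φ (m := m)]
    exact luxemburgNorm_congr φ (AEEqFun.coeFn_zero (μ := m) (β := ℂ))
  refine le_antisymm (luxemburgNorm_smul_le φ hc f) ?_
  have h := luxemburgNorm_smul_le φ (inv_ne_zero hc) (c • f)
  rw [inv_smul_smul₀ hc, norm_inv] at h
  rwa [le_inv_mul_iff₀ (norm_pos_iff.2 hc)] at h

theorem eq_zero_of_luxemburgNorm_eq_zero (f : OrliczSpace φ m)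
    (h : luxemburgNorm φ m (f : Ω →ₘ[m] ℂ) = 0) : f = 0 := by
  have hall : ∀ k : ℝ, 0 < k → ∫⁻ x, φ (‖(f : Ω →ₘ[m] ℂ) x‖ / k) ∂m ≤ 1 := by
    intro k hk
    obtain ⟨l, ⟨hl, hl1⟩, hlk⟩ := Real.lt_sInf_add_pos (luxemburg_nonempty φ f) hk
    have hlk' : l < luxemburgNorm φ m (f : Ω →ₘ[m] ℂ) + k := hlk
    rw [h, zero_add] at hlk'
    refine (lintegral_mono fun x => φ.mono (by positivity) ?_).trans hl1
    gcongr
  have hnull : ∀ t : ℝ, 0 < t → m {x | t ≤ ‖(f : Ω →ₘ[m] ℂ) x‖} = 0 := by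
    intro t ht
    set S := {x | t ≤ ‖(f : Ω →ₘ[m] ℂ) x‖} with hS
    by_contra hne
    have hev := φ.tendsto_top'.eventually
      (lt_mem_nhds (show (m S)⁻¹ < ∞ from ENNReal.inv_lt_top.2 (pos_iff_ne_zero.2 hne)))
    obtain ⟨y, hy, hy0⟩ := (hev.and (eventually_gt_atTop 0)).exists
    have hmeas : AEMeasurable (fun x => φ (‖(f : Ω →ₘ[m] ℂ) x‖ / (t / y))) m :=
      φ.aemeasurable_comp ((f : Ω →ₘ[m] ℂ).aestronglyMeasurable.norm.aemeasurable.div_const _)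
        fun x => by positivity
    have h1 := (mul_meas_ge_le_lintegral₀ hmeas (φ y)).trans (hall (t / y) (by positivity))
    have h2 : m S ≤ m {x | φ y ≤ φ (‖(f : Ω →ₘ[m] ℂ) x‖ / (t / y))} := by
      refine measure_mono fun x hx => φ.mono hy0.le ?_
      rw [le_div_iff₀ (by positivity), mul_div_cancel₀ _ hy0.ne']
      exact hx
    have h3 : φ y * m S ≤ 1 := (mul_le_mul_right h2 _).trans h1
    exact absurd (ENNReal.le_inv_iff_mul_le.2 h3) (not_le.2 hy)
  have hae : (f : Ω →ₘ[m] ℂ) =ᵐ[m] (0 : Ω → ℂ) := by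
    have : ∀ n : ℕ, ∀ᵐ x ∂m, ‖(f : Ω →ₘ[m] ℂ) x‖ < 1 / ((n : ℝ) + 1) := fun n => by
      have := hnull (1 / ((n : ℝ) + 1)) (by positivity)
      rw [ae_iff]
      simpa only [not_lt] using this
    filter_upwards [ae_all_iff.2 this] with x hx
    refine norm_le_zero_iff.1 (le_of_forall_pos_lt_add fun ε hε => ?_)
    obtain ⟨n, hn⟩ := exists_nat_one_div_lt hε
    rw [zero_add]
    exact (hx n).trans hn
  refine Subtype.ext (AEEqFun.ext ?_)
  exact hae.trans (AEEqFun.coeFn_zero (μ := m) (β := ℂ)).symm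

noncomputable instance OrliczSpace.instNorm : Norm (OrliczSpace φ m) :=
  ⟨fun f => luxemburgNorm φ m (f : Ω →ₘ[m] ℂ)⟩

theorem OrliczSpace.core : NormedSpace.Core ℂ (OrliczSpace φ m) where
  norm_nonneg f := luxemburgNorm_nonneg φ m _
  norm_smul c f := luxemburgNorm_smul φ c f
  norm_triangle f g := luxemburgNorm_add_le φ f g
  norm_eq_zero_iff f := by
    refine ⟨eq_zero_of_luxemburgNorm_eq_zero φ f, ?_⟩
    rintro rfl
    refine Eq.trans ?_ (luxemburgNorm_zero φ (m := m))
    exact luxemburgNorm_congr φ (AEEqFun.coeFn_zero (μ := m) (β := ℂ))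

/-- `L^φ(Ω, m)` is normed by the Luxemburg norm. -/
noncomputable instance OrliczSpace.instNormedAddCommGroup :
    NormedAddCommGroup (OrliczSpace φ m) :=
  NormedAddCommGroup.ofCore (OrliczSpace.core φ)

noncomputable instance OrliczSpace.instNormedSpace : NormedSpace ℂ (OrliczSpace φ m) :=
  NormedSpace.ofCore (OrliczSpace.core φ)

theorem OrliczSpace.norm_def (f : OrliczSpace φ m) :
    ‖f‖ = luxemburgNorm φ m (f : Ω →ₘ[m] ℂ) := rfl

end Orlicz

/-! ### Continuous functions with compact support inside `L^φ` and `L¹` -/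

section CompactlySupported

variable {Ω : Type*} [TopologicalSpace Ω] [MeasurableSpace Ω] [BorelSpace Ω]

/-- The class of `f ∈ C_c(Ω)` in `L^φ(Ω, m)`. -/
noncomputable def ccToOrlicz (φ : YoungFunction) (m : Measure Ω) [IsFiniteMeasureOnCompacts m]
    (f : C_c(Ω, ℂ)) : OrliczSpace φ m :=
  ⟨AEEqFun.mk f f.continuous.aestronglyMeasurable, by
    obtain ⟨t, ht, htop⟩ := φ.exists_pos_lt_top
    obtain ⟨C, hC⟩ := f.hasCompactSupport.exists_bound_of_continuous f.continuous
    have hpos : 0 < |C| + 1 := by positivity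
    refine ⟨t / (|C| + 1), by positivity, ?_⟩
    rw [orliczModular_congr φ (v := fun x => ((t / (|C| + 1) : ℝ) : ℂ) * f x)
      ((AEEqFun.coeFn_mk (f : Ω → ℂ) f.continuous.aestronglyMeasurable).mono
        fun x hx => by simp only [hx])]
    have hle : ∀ x, φ ‖((t / (|C| + 1) : ℝ) : ℂ) * f x‖
        ≤ (tsupport f).indicator (fun _ => φ t) x := by
      intro x
      by_cases hx : x ∈ tsupport f
      · rw [indicator_of_mem hx]
        refine φ.mono (norm_nonneg _) ?_
        rw [norm_mul, Complex.norm_real, Real.norm_of_nonneg (by positivity), div_mul_eq_mul_div,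
          div_le_iff₀ hpos]
        gcongr
        exact (hC x).trans ((le_abs_self C).trans (by linarith))
      · rw [indicator_of_notMem hx, image_eq_zero_of_notMem_tsupport hx]
        simp [φ.map_zero]
    refine (lintegral_mono hle).trans_lt ?_
    refine (lintegral_indicator_const_le _ _).trans_lt ?_
    exact ENNReal.mul_lt_top htop f.hasCompactSupport.isCompact.measure_lt_top⟩

/-- The class of `f ∈ C_c(Ω)` in `L¹(Ω, m)`. -/
noncomputable def ccToL1 (m : Measure Ω) [IsFiniteMeasureOnCompacts m] (f : C_c(Ω, ℂ)) :
    Lp ℂ 1 m :=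
  (f.continuous.memLp_of_hasCompactSupport f.hasCompactSupport : MemLp f 1 m).toLp f

end CompactlySupported

/-! ### Harmonic analysis on `G ⧸ H` for a compact subgroup `H` -/

section Coset

variable {G : Type*} [Group G] [TopologicalSpace G] [IsTopologicalGroup G]
  [MeasurableSpace G] [BorelSpace G] (H : Subgroup G) [CompactSpace H]

/-- The normalized Haar measure `dh` on a compact subgroup `H`. -/
noncomputable def normalizedHaar : Measure H :=
  haveI : BorelSpace H := Subtype.borelSpace _
  Measure.haarMeasure ⊤

instance normalizedHaar.isHaarMeasure : (normalizedHaar H).IsHaarMeasure :=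
  haveI : BorelSpace H := Subtype.borelSpace _
  inferInstanceAs (Measure.haarMeasure (⊤ : TopologicalSpace.PositiveCompacts H)).IsHaarMeasure

instance normalizedHaar.isProbabilityMeasure : IsProbabilityMeasure (normalizedHaar H) :=
  ⟨haveI : BorelSpace H := Subtype.borelSpace _
   Measure.haarMeasure_self (K₀ := (⊤ : TopologicalSpace.PositiveCompacts H))⟩

instance normalizedHaar.regular : (normalizedHaar H).Regular :=
  haveI : BorelSpace H := Subtype.borelSpace _
  inferInstanceAs (Measure.haarMeasure (⊤ : TopologicalSpace.PositiveCompacts H)).Regular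

theorem normalizedHaar_map_mul_right (k : H) :
    (normalizedHaar H).map (· * k) = normalizedHaar H := by
  have : BorelSpace H := Subtype.borelSpace _
  have : IsProbabilityMeasure ((normalizedHaar H).map (· * k)) :=
    Measure.isProbabilityMeasure_map (measurable_mul_const k).aemeasurable
  exact Measure.isHaarMeasure_eq_of_isProbabilityMeasure _ _

theorem integral_normalizedHaar_mul_right (F : H → ℂ) (k : H) :
    ∫ h, F (h * k) ∂(normalizedHaar H) = ∫ h, F h ∂(normalizedHaar H) := by
  have : BorelSpace H := Subtype.borelSpace _
  have : (normalizedHaar H).IsMulRightInvariant := ⟨normalizedHaar_map_mul_right H⟩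
  exact integral_mul_right_eq_self F k

theorem integral_normalizedHaar_mul_left (F : H → ℂ) (k : H) :
    ∫ h, F (k * h) ∂(normalizedHaar H) = ∫ h, F h ∂(normalizedHaar H) := by
  have : BorelSpace H := Subtype.borelSpace _
  exact integral_mul_left_eq_self F k

/-- `T_H f (xH) = ∫_H f (x h) dh`. -/
noncomputable def cosetAverage (f : G → ℂ) : G ⧸ H → ℂ :=
  Quotient.lift (fun x : G => ∫ h : H, f (x * h) ∂(normalizedHaar H)) (by
    intro x y hxy
    have hk : x⁻¹ * y ∈ H := QuotientGroup.leftRel_apply.1 hxy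
    have h := integral_normalizedHaar_mul_left H (fun h => f (x * h)) ⟨x⁻¹ * y, hk⟩
    simp only [Subgroup.coe_mul, mul_assoc, mul_inv_cancel_left] at h
    exact h.symm)

/-- `J g (xH) = ∫_H g (h x H) dh`. -/
noncomputable def leftAverage (g : G ⧸ H → ℂ) (z : G ⧸ H) : ℂ :=
  ∫ h : H, g ((h : G) • z) ∂(normalizedHaar H)

theorem leftAverage_smul (g : G ⧸ H → ℂ) (k : H) (z : G ⧸ H) :
    leftAverage H g ((k : G) • z) = leftAverage H g z := by
  unfold leftAverage
  simp only [smul_smul]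
  exact integral_normalizedHaar_mul_right H (fun h => g ((h : G) • z)) k

/-- The kernel `(yH, xH) ↦ J g (y⁻¹ x H)`, which depends only on the two cosets. -/
noncomputable def convKernel (g : G ⧸ H → ℂ) (w z : G ⧸ H) : ℂ :=
  Quotient.lift (fun y : G => leftAverage H g (y⁻¹ • z)) (by
    intro y y' hyy
    have hk : y⁻¹ * y' ∈ H := QuotientGroup.leftRel_apply.1 hyy
    have h := leftAverage_smul H g ⟨y⁻¹ * y', hk⟩ (y'⁻¹ • z)
    simp only [smul_smul, mul_assoc, mul_inv_cancel, mul_one] at h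
    exact h) w

variable [MeasurableSpace (G ⧸ H)]

/-- The convolution `(f * g)(xH) = ∫ f (yH) J g (y⁻¹ x H) dm(yH)` over `G ⧸ H`. -/
noncomputable def cosetConv (m : Measure (G ⧸ H)) (f g : G ⧸ H → ℂ) (z : G ⧸ H) : ℂ :=
  ∫ w, f w * convKernel H g w z ∂m

/-- The Radon measure `m` is the normalized `G`-invariant measure on `G ⧸ H` associated with the
Haar measure `μ` of `G`: it is `G`-invariant and satisfies Weil's formula
`∫_{G/H} T_H f dm = ∫_G f dμ` for `f ∈ C_c(G)`. -/
structure IsNormalizedInvariant (μ : Measure G) (m : Measure (G ⧸ H)) [m.Regular] : Prop where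
  invariant : SMulInvariantMeasure G (G ⧸ H) m
  weil : ∀ f : C_c(G, ℂ), ∫ z, cosetAverage H f z ∂m = ∫ x, f x ∂μ

end Coset

/-! ### Banach algebras and Banach modules given by bilinear maps -/

/-- The bilinear product `mul` makes the complex normed space `A` a (not necessarily unital)
Banach algebra. -/
structure IsBanachAlgebraProduct {A : Type*} [NormedAddCommGroup A] [NormedSpace ℂ A]
    (mul : A →ₗ[ℂ] A →ₗ[ℂ] A) : Prop where
  complete : CompleteSpace A
  mul_assoc : ∀ a b c, mul (mul a b) c = mul a (mul b c)
  norm_mul_le : ∀ a b, ‖mul a b‖ ≤ ‖a‖ * ‖b‖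

/-- The bilinear map `act` makes the complex normed space `X` a Banach left module over the Banach
algebra `A` with product `mul`. -/
structure IsBanachLeftModule {A X : Type*} [NormedAddCommGroup A] [NormedSpace ℂ A]
    [NormedAddCommGroup X] [NormedSpace ℂ X]
    (mul : A →ₗ[ℂ] A →ₗ[ℂ] A) (act : A →ₗ[ℂ] X →ₗ[ℂ] X) : Prop where
  algebra : IsBanachAlgebraProduct mul
  complete : CompleteSpace X
  mul_act : ∀ a b x, act (mul a b) x = act a (act b x)
  norm_act_le : ∀ a x, ‖act a x‖ ≤ ‖a‖ * ‖x‖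

/-! ### Lower semicontinuity of Young functions and Fatou's lemma -/

/-! The convolution is a vector-valued average of translates. For `g` in `L¹`, averaging its
translates over `H` gives `J g`, and `yH ↦ J g (y⁻¹ ·)` is a bounded continuous map `orbitMap` from
`G ⧸ H` to `L¹`. So `f * g = ∫ f(w) • orbitMap g w dm(w)` makes sense as a Bochner integral, and
bilinearity and `‖f * g‖₁ ≤ ‖f‖₁ ‖g‖₁` are immediate. By invariance of `m`, the operator `T = (· *
k)` commutes with translations, and every bounded operator with that property satisfies `T (f * g) =
f * T g` (`map_convL1`); this is associativity.

For the Luxemburg norm, the set `modularBall φ m k` of all `u` in `L¹` with `∫ φ(|u| / k) ≤ 1` is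
convex, balanced and translation invariant, and Fatou's lemma makes it closed in `L¹`. Averages of
its members therefore stay in it (`Convex.exists_integral_smul_eq`), which yields `‖f * g‖_φ ≤ ‖f‖₁
‖g‖_φ` for `g` in `L¹ ∩ L^φ`, without any pointwise estimate of the convolution. This intersection
is dense in `L^φ` (`dense_integrablePart`): it is the whole space if `m` is finite, and otherwise
`Δ₂` allows small values to be cut off. The action extends by continuity, and the module identities
pass to the closure.

On `C_c`, Fubini identifies the Bochner integral with `cosetConv` (`convL1_ccToL1`). Completeness of
`L^φ` is a Riesz–Fischer argument, with Fatou's lemma controlling the tails. -/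

namespace YoungFunction

variable (φ : YoungFunction)

/-- Left continuity and monotonicity together give lower semicontinuity: a point `y` slightly below
`x` already has `φ y` close to `φ x`, and `u i` eventually exceeds `y`. This is what makes Fatou's
lemma applicable to modulars, even where `φ` jumps to `∞`. -/
theorem le_liminf {ι : Type*} {l : Filter ι} {u : ι → ℝ} {x : ℝ} (hu : Tendsto u l (𝓝 x))
    (hx : 0 ≤ x) : φ x ≤ liminf (fun i => φ (u i)) l := by
  refine le_of_forall_lt fun c hc => ?_
  obtain ⟨d, hcd, hd⟩ := exists_between hc
  refine hcd.trans_le (le_liminf_of_le (by isBoundedDefault) ?_)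
  rcases hx.eq_or_lt with rfl | hx
  · simp [φ.map_zero] at hc
  have h1 : ∀ᶠ y in 𝓝[<] x, d < φ y :=
    nhdsWithin_mono _ Iio_subset_Iic_self ((φ.leftCont' x hx.le).eventually (lt_mem_nhds hd))
  have h2 : ∀ᶠ y in 𝓝[<] x, 0 < y := nhdsWithin_le_nhds (lt_mem_nhds hx)
  obtain ⟨y, ⟨hy1, hy2⟩, hy3⟩ := ((h1.and h2).and self_mem_nhdsWithin).exists
  filter_upwards [hu.eventually (lt_mem_nhds (show y < x from hy3))] with i hi
  exact hy1.le.trans (φ.mono hy2.le hi.le)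

theorem lintegral_le_of_tendsto {Ω : Type*} [MeasurableSpace Ω] {m : Measure Ω}
    {u : ℕ → Ω → ℝ} {v : Ω → ℝ} (hu : ∀ n, AEMeasurable (u n) m) (h0 : ∀ n x, 0 ≤ u n x)
    (hv : ∀ᵐ x ∂m, Tendsto (fun n => u n x) atTop (𝓝 (v x))) {C : ℝ≥0∞}
    (hC : ∀ n, ∫⁻ x, φ (u n x) ∂m ≤ C) : ∫⁻ x, φ (v x) ∂m ≤ C := by
  calc ∫⁻ x, φ (v x) ∂m ≤ ∫⁻ x, liminf (fun n => φ (u n x)) atTop ∂m :=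
        lintegral_mono_ae (hv.mono fun x hx =>
          φ.le_liminf hx (ge_of_tendsto' hx fun n => h0 n x))
    _ ≤ liminf (fun n => ∫⁻ x, φ (u n x) ∂m) atTop :=
        lintegral_liminf_le' fun n => φ.aemeasurable_comp (hu n) (h0 n)
    _ ≤ C := liminf_le_of_le (by isBoundedDefault) fun b hb => by
        obtain ⟨n, hn⟩ := hb.exists
        exact hn.trans (hC n)

/-- Above a point where it is positive, a Young function grows at least linearly. -/
theorem ofReal_mul_le {t s : ℝ} (ht : 0 < t) (hts : t ≤ s) :
    ENNReal.ofReal s * φ t ≤ ENNReal.ofReal t * φ s := by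
  have hs : 0 < s := ht.trans_le hts
  have h := φ.map_mul_le (a := t / s) (x := s) (by positivity) ((div_le_one hs).2 hts)
  rw [div_mul_cancel₀ _ hs.ne'] at h
  calc ENNReal.ofReal s * φ t ≤ ENNReal.ofReal s * (ENNReal.ofReal (t / s) * φ s) := by gcongr
    _ = ENNReal.ofReal t * φ s := by
      rw [← mul_assoc, ← ENNReal.ofReal_mul hs.le, mul_div_cancel₀ _ hs.ne']

end YoungFunction

/-! ### Completeness of Orlicz spaces -/

namespace OrliczSpace

variable {Ω : Type*} [MeasurableSpace Ω] {m : Measure Ω} {φ : YoungFunction}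

/-- The infimum in the Luxemburg norm is attained: Fatou's lemma is applied along the scales `k + 1
/ (n + 1)`, which decrease to `k`. Norm bounds thus become modular bounds. -/
theorem norm_le_iff (f : OrliczSpace φ m) {k : ℝ} (hk : 0 < k) :
    ‖f‖ ≤ k ↔ ∫⁻ x, φ (‖(f : Ω →ₘ[m] ℂ) x‖ / k) ∂m ≤ 1 := by
  refine ⟨fun h => ?_, fun h => csInf_le (luxemburg_bddBelow φ m _) ⟨hk, h⟩⟩
  have hpos : ∀ n : ℕ, 0 < k + 1 / ((n : ℝ) + 1) := fun n => by positivity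
  refine φ.lintegral_le_of_tendsto
    (u := fun (n : ℕ) x => ‖(f : Ω →ₘ[m] ℂ) x‖ / (k + 1 / ((n : ℝ) + 1)))
    (fun n => (f : Ω →ₘ[m] ℂ).aestronglyMeasurable.norm.aemeasurable.div_const _)
    (fun n x => div_nonneg (norm_nonneg _) (hpos n).le) (Eventually.of_forall fun x => ?_)
    fun n => ?_
  · refine tendsto_const_nhds.div ?_ hk.ne'
    simpa using (tendsto_const_nhds (x := k)).add tendsto_one_div_add_atTop_nhds_zero_nat
  · have hlt : ‖f‖ < k + 1 / ((n : ℝ) + 1) := h.trans_lt (lt_add_of_pos_right _ (by positivity))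
    obtain ⟨l, ⟨hl, hl1⟩, hlk⟩ := (csInf_lt_iff (luxemburg_bddBelow φ m _)
      (luxemburg_nonempty φ f)).1 hlt
    refine (lintegral_mono fun x => φ.mono (div_nonneg (norm_nonneg _) (hpos n).le) ?_).trans hl1
    gcongr

theorem mem_of_lintegral_le_one {f : Ω →ₘ[m] ℂ} {k : ℝ} (hk : 0 < k)
    (h : ∫⁻ x, φ (‖f x‖ / k) ∂m ≤ 1) : f ∈ OrliczSpace φ m := by
  refine ⟨k⁻¹, inv_pos.2 hk, lt_of_le_of_lt (le_of_eq ?_) (h.trans_lt ENNReal.one_lt_top)⟩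
  simp [orliczModular, abs_of_pos hk, div_eq_inv_mul]

/-- If `‖u n‖ ≤ k n` with `∑ k n ≤ S`, then the partial sums of `∑ |u n| / S` have modular at most
one. -/
theorem lintegral_sum_le_one (u : ℕ → OrliczSpace φ m) (k : ℕ → ℝ) (hk : ∀ n, 0 < k n)
    (hu : ∀ n, ‖u n‖ ≤ k n) {S : ℝ} (hS : 0 < S) (s : Finset ℕ) (hsum : ∑ i ∈ s, k i ≤ S) :
    ∫⁻ x, φ ((∑ i ∈ s, ‖(u i : Ω →ₘ[m] ℂ) x‖) / S) ∂m ≤ 1 := by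
  have key : ∀ x, φ ((∑ i ∈ s, ‖(u i : Ω →ₘ[m] ℂ) x‖) / S)
      ≤ ∑ i ∈ s, ENNReal.ofReal (k i / S) * φ (‖(u i : Ω →ₘ[m] ℂ) x‖ / k i) := by
    intro x
    -- `T` is quantified because peeling off the term `a` leaves the budget `T - k a` for the
    -- others. The singleton case is separate, since there the remaining budget may be zero; weights
    -- adding up to less than one are harmless because `φ 0 = 0`.
    have aux : ∀ t : Finset ℕ, ∀ T : ℝ, 0 < T → ∑ i ∈ t, k i ≤ T →
        φ ((∑ i ∈ t, ‖(u i : Ω →ₘ[m] ℂ) x‖) / T)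
          ≤ ∑ i ∈ t, ENNReal.ofReal (k i / T) * φ (‖(u i : Ω →ₘ[m] ℂ) x‖ / k i) := by
      intro t
      induction t using Finset.induction_on with
      | empty => intro T _ _; simp [φ.map_zero]
      | insert a t ha ih =>
        intro T hT hle
        rw [Finset.sum_insert ha] at hle
        rw [Finset.sum_insert ha, Finset.sum_insert ha]
        have hkt : 0 ≤ ∑ i ∈ t, k i := Finset.sum_nonneg fun i _ => (hk i).le
        rcases t.eq_empty_or_nonempty with rfl | hne
        · simp only [Finset.sum_empty, add_zero] at hle ⊢
          have : ‖(u a : Ω →ₘ[m] ℂ) x‖ / T = k a / T * (‖(u a : Ω →ₘ[m] ℂ) x‖ / k a) := by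
            have := (hk a).ne'
            field_simp
          rw [this]
          exact φ.map_mul_le (div_nonneg (hk a).le hT.le) ((div_le_one hT).2 hle)
        · have hpos : 0 < ∑ i ∈ t, k i := Finset.sum_pos (fun i _ => hk i) hne
          have hT' : 0 < T - k a := by linarith
          have e : (‖(u a : Ω →ₘ[m] ℂ) x‖ + ∑ i ∈ t, ‖(u i : Ω →ₘ[m] ℂ) x‖) / T
              = k a / T * (‖(u a : Ω →ₘ[m] ℂ) x‖ / k a)
                + (T - k a) / T * ((∑ i ∈ t, ‖(u i : Ω →ₘ[m] ℂ) x‖) / (T - k a)) := by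
            have := (hk a).ne'
            have := hT'.ne'
            field_simp
          rw [e]
          refine (φ.convex_le _ _ (div_nonneg (hk a).le hT.le) (by positivity)
            (by field_simp; ring)).trans ?_
          gcongr
          refine (mul_le_mul_right (ih (T - k a) hT' (by linarith)) _).trans ?_
          rw [Finset.mul_sum]
          refine Finset.sum_le_sum fun i _ => ?_
          rw [← mul_assoc, ← ENNReal.ofReal_mul (by positivity)]
          refine mul_le_mul_left (ENNReal.ofReal_le_ofReal (le_of_eq ?_)) _
          field_simp
    exact aux s S hS hsum
  calc ∫⁻ x, φ ((∑ i ∈ s, ‖(u i : Ω →ₘ[m] ℂ) x‖) / S) ∂m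
      ≤ ∫⁻ x, ∑ i ∈ s, ENNReal.ofReal (k i / S) * φ (‖(u i : Ω →ₘ[m] ℂ) x‖ / k i) ∂m :=
        lintegral_mono key
    _ = ∑ i ∈ s, ENNReal.ofReal (k i / S) * ∫⁻ x, φ (‖(u i : Ω →ₘ[m] ℂ) x‖ / k i) ∂m := by
        have hm : ∀ i, AEMeasurable (fun x => φ (‖(u i : Ω →ₘ[m] ℂ) x‖ / k i)) m := fun i =>
          φ.aemeasurable_comp
            ((u i : Ω →ₘ[m] ℂ).aestronglyMeasurable.norm.aemeasurable.div_const _)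
            fun x => div_nonneg (norm_nonneg _) (hk i).le
        rw [lintegral_finsetSum' _ fun i _ => (hm i).const_mul _]
        exact Finset.sum_congr rfl fun i _ => lintegral_const_mul'' _ (hm i)
    _ ≤ ∑ i ∈ s, ENNReal.ofReal (k i / S) * 1 := by
        gcongr with i
        exact (norm_le_iff _ (hk i)).1 (hu i)
    _ = ENNReal.ofReal ((∑ i ∈ s, k i) / S) := by
        simp only [mul_one]
        rw [← ENNReal.ofReal_sum_of_nonneg fun i _ => div_nonneg (hk i).le hS.le, Finset.sum_div]
    _ ≤ 1 := ENNReal.ofReal_le_one.2 ((div_le_one hS).2 hsum)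

/-- By monotone convergence the supremum over `N` of `φ` of the scaled partial sums has integral at
most one, hence is finite almost everywhere. Since `φ` tends to `∞`, a finite supremum bounds the
partial sums. -/
theorem ae_summable_norm (u : ℕ → OrliczSpace φ m) (k : ℕ → ℝ) (hk : ∀ n, 0 < k n)
    (hu : ∀ n, ‖u n‖ ≤ k n) (hsum : Summable k) :
    ∀ᵐ x ∂m, Summable fun n => ‖(u n : Ω →ₘ[m] ℂ) x‖ := by
  have hS : 0 < ∑' n, k n := hsum.tsum_pos (fun n => (hk n).le) 0 (hk 0)
  set S := ∑' n, k n with hSdef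
  have hmeas : ∀ N : ℕ, AEMeasurable
      (fun x => φ ((∑ i ∈ Finset.range N, ‖(u i : Ω →ₘ[m] ℂ) x‖) / S)) m := fun N =>
    φ.aemeasurable_comp ((Finset.aemeasurable_fun_sum _ fun i _ =>
      (u i : Ω →ₘ[m] ℂ).aestronglyMeasurable.norm.aemeasurable).div_const _)
      fun x => by positivity
  have hmono : ∀ x, Monotone fun N : ℕ =>
      φ ((∑ i ∈ Finset.range N, ‖(u i : Ω →ₘ[m] ℂ) x‖) / S) := fun x a b hab =>
    φ.mono (by positivity) (by gcongr)
  have hint : ∫⁻ x, ⨆ N : ℕ, φ ((∑ i ∈ Finset.range N, ‖(u i : Ω →ₘ[m] ℂ) x‖) / S) ∂m ≤ 1 := by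
    rw [lintegral_iSup' hmeas (Eventually.of_forall hmono)]
    exact iSup_le fun N => lintegral_sum_le_one u k hk hu hS _
      (hsum.sum_le_tsum _ fun i _ => (hk i).le)
  filter_upwards [ae_lt_top' (AEMeasurable.iSup hmeas) (hint.trans_lt ENNReal.one_lt_top).ne]
    with x hx
  obtain ⟨y, hy, hy0⟩ := ((φ.tendsto_top'.eventually (lt_mem_nhds hx)).and
    (eventually_gt_atTop 0)).exists
  refine summable_of_sum_range_le (c := y * S) (fun n => norm_nonneg _) fun N => ?_
  by_contra! hlt
  have h1 : y ≤ (∑ i ∈ Finset.range N, ‖(u i : Ω →ₘ[m] ℂ) x‖) / S := (le_div_iff₀ hS).2 hlt.le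
  exact absurd ((φ.mono hy0.le h1).trans
    (le_iSup (fun N : ℕ => φ ((∑ i ∈ Finset.range N, ‖(u i : Ω →ₘ[m] ℂ) x‖) / S)) N)) (not_le.2 hy)

/-- Orlicz spaces are complete for the Luxemburg norm. -/
instance instCompleteSpace : CompleteSpace (OrliczSpace φ m) := by
  refine NormedAddCommGroup.completeSpace_of_summable_imp_tendsto fun u hu => ?_
  -- The geometric term makes the bounds strictly positive even where `u n = 0`, so that one may
  -- divide by them.
  set k : ℕ → ℝ := fun n => ‖u n‖ + (1 / 2) ^ n with hkdef
  have hk : ∀ n, 0 < k n := fun n => by positivity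
  have huk : ∀ n, ‖u n‖ ≤ k n := fun n => le_add_of_nonneg_right (by positivity)
  have hksum : Summable k := hu.add summable_geometric_two
  have hae := ae_summable_norm u k hk huk hksum
  set v : Ω → ℂ := fun x => ∑' n, (u n : Ω →ₘ[m] ℂ) x with hv
  have hlim : ∀ᵐ x ∂m, Tendsto (fun N => ∑ i ∈ Finset.range N, (u i : Ω →ₘ[m] ℂ) x) atTop
      (𝓝 (v x)) := hae.mono fun x hx => hx.of_norm.hasSum.tendsto_sum_nat
  have hcoe : ∀ N : ℕ, (((∑ i ∈ Finset.range N, u i : OrliczSpace φ m) : Ω →ₘ[m] ℂ) : Ω → ℂ)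
      =ᵐ[m] fun x => ∑ i ∈ Finset.range N, (u i : Ω →ₘ[m] ℂ) x := by
    intro N
    induction N with
    | zero =>
      simp only [Finset.range_zero, Finset.sum_empty, ZeroMemClass.coe_zero]
      exact AEEqFun.coeFn_zero (μ := m) (β := ℂ)
    | succ N ih =>
      rw [Finset.sum_range_succ, Submodule.coe_add]
      filter_upwards [AEEqFun.coeFn_add ((∑ i ∈ Finset.range N, u i : OrliczSpace φ m) :
        Ω →ₘ[m] ℂ) (u N : Ω →ₘ[m] ℂ), ih] with x hx hx'
      rw [hx, Pi.add_apply, hx', Finset.sum_range_succ]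
  have hvm : AEStronglyMeasurable v m := aestronglyMeasurable_of_tendsto_ae atTop
    (fun N => ((∑ i ∈ Finset.range N, u i : OrliczSpace φ m) :
      Ω →ₘ[m] ℂ).aestronglyMeasurable.congr (hcoe N)) hlim
  -- By Fatou's lemma in the upper limit `M`, the remainder after `N` terms has norm at most the
  -- tail `∑ k (n + N)`, which tends to zero. The case `N = 0` also shows that the limit lies in the
  -- Orlicz space.
  have htail : ∀ N : ℕ, ∫⁻ x, φ (‖v x - ∑ i ∈ Finset.range N, (u i : Ω →ₘ[m] ℂ) x‖
      / ∑' n, k (n + N)) ∂m ≤ 1 := by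
    intro N
    have hs : Summable fun n => k (n + N) := (summable_nat_add_iff N).2 hksum
    have hT : 0 < ∑' n, k (n + N) := hs.tsum_pos (fun n => (hk _).le) 0 (hk _)
    refine φ.lintegral_le_of_tendsto
      (u := fun M x => ‖∑ i ∈ Finset.range M, (u (i + N) : Ω →ₘ[m] ℂ) x‖ / ∑' n, k (n + N))
      (fun M => AEMeasurable.div_const (AEStronglyMeasurable.norm
        (Finset.aestronglyMeasurable_fun_sum _ fun i _ =>
          (u (i + N) : Ω →ₘ[m] ℂ).aestronglyMeasurable)).aemeasurable _)
      (fun M x => by positivity) ?_ fun M => ?_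
    · filter_upwards [hae] with x hx
      have h1 := ((summable_nat_add_iff N).2 hx.of_norm).hasSum.tendsto_sum_nat
      have h2 := hx.of_norm.sum_add_tsum_nat_add N
      rw [show v x - ∑ i ∈ Finset.range N, (u i : Ω →ₘ[m] ℂ) x
        = ∑' n, (u (n + N) : Ω →ₘ[m] ℂ) x by rw [hv]; simp only; rw [← h2]; ring]
      exact h1.norm.div_const _
    · refine (lintegral_mono fun x => φ.mono (by positivity) ?_).trans
        (lintegral_sum_le_one (fun n => u (n + N)) (fun n => k (n + N)) (fun n => hk _)
          (fun n => huk _) hT (Finset.range M) (hs.sum_le_tsum _ fun i _ => (hk _).le))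
      gcongr
      exact norm_sum_le _ _
  have htpos : ∀ N : ℕ, 0 < ∑' n, k (n + N) := fun N =>
    ((summable_nat_add_iff N).2 hksum).tsum_pos (fun n => (hk _).le) 0 (hk _)
  have hmem : AEEqFun.mk v hvm ∈ OrliczSpace φ m := by
    refine mem_of_lintegral_le_one (htpos 0) (le_of_eq_of_le ?_ (htail 0))
    refine lintegral_congr_ae ((AEEqFun.coeFn_mk v hvm).mono fun x hx => ?_)
    simp only [hx, Finset.range_zero, Finset.sum_empty, sub_zero]
  refine ⟨⟨_, hmem⟩, ?_⟩
  rw [tendsto_iff_norm_sub_tendsto_zero]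
  refine squeeze_zero (fun N => norm_nonneg _) (fun N => ?_) (tendsto_sum_nat_add k)
  rw [norm_sub_rev, norm_le_iff _ (htpos N)]
  refine le_of_eq_of_le (lintegral_congr_ae ?_) (htail N)
  filter_upwards [AEEqFun.coeFn_mk v hvm, hcoe N, AEEqFun.coeFn_sub (AEEqFun.mk v hvm)
    ((∑ i ∈ Finset.range N, u i : OrliczSpace φ m) : Ω →ₘ[m] ℂ)] with x h1 h2 h3
  rw [Submodule.coe_sub, h3, Pi.sub_apply, h1, h2]

end OrliczSpace

/-! ### Integrable functions are dense in Orlicz spaces -/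

namespace YoungFunction

variable {φ : YoungFunction}

/-- A zero at `x > 0` would propagate by doubling to every `2 ^ n * x`, contradicting `φ → ∞`. -/
theorem pos_of_le_mul {C : ℝ≥0} (hC : ∀ x, 0 ≤ x → φ (2 * x) ≤ C * φ x) {x : ℝ} (hx : 0 < x) :
    0 < φ x := by
  by_contra! h
  have hzero : ∀ n : ℕ, φ (2 ^ n * x) = 0 := by
    intro n
    induction n with
    | zero => simpa using h
    | succ n ih =>
      have := hC (2 ^ n * x) (by positivity)
      rw [ih, mul_zero, ← mul_assoc, ← pow_succ'] at this
      exact le_antisymm this zero_le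
  obtain ⟨y, hy⟩ := (φ.tendsto_top'.eventually
    (lt_mem_nhds (show (0 : ℝ≥0∞) < ∞ from ENNReal.zero_lt_top))).exists_forall_of_atTop
  obtain ⟨n, hn⟩ := pow_unbounded_of_one_lt (y / x) (one_lt_two (α := ℝ))
  exact (hy _ ((div_le_iff₀ hx).1 hn.le)).ne' (hzero n)

/-- Each doubling of the scale costs a factor `C`, so a modular that is finite at one positive scale
is finite at all of them. This supplies the dominating function in `dense_integrablePart`. -/
theorem lintegral_mul_lt_top_of_le_mul {C : ℝ≥0} (hC : ∀ x, 0 ≤ x → φ (2 * x) ≤ C * φ x)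
    {Ω : Type*} [MeasurableSpace Ω] {m : Measure Ω} {u : Ω → ℝ} (h0 : ∀ x, 0 ≤ u x) {a : ℝ}
    (ha : 0 < a) (h : ∫⁻ x, φ (a * u x) ∂m < ∞) {c : ℝ} (hc : 0 ≤ c) :
    ∫⁻ x, φ (c * u x) ∂m < ∞ := by
  have hpow : ∀ n : ℕ, ∫⁻ x, φ (2 ^ n * a * u x) ∂m < ∞ := by
    intro n
    induction n with
    | zero => simpa using h
    | succ n ih =>
      calc ∫⁻ x, φ (2 ^ (n + 1) * a * u x) ∂m ≤ ∫⁻ x, C * φ (2 ^ n * a * u x) ∂m := by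
            refine lintegral_mono fun x => ?_
            have := h0 x
            convert hC (2 ^ n * a * u x) (by positivity) using 2
            ring
        _ = C * ∫⁻ x, φ (2 ^ n * a * u x) ∂m := lintegral_const_mul' _ _ ENNReal.coe_ne_top
        _ < ∞ := ENNReal.mul_lt_top ENNReal.coe_lt_top ih
  obtain ⟨n, hn⟩ := pow_unbounded_of_one_lt (c / a) (one_lt_two (α := ℝ))
  refine (lintegral_mono fun x => φ.mono (mul_nonneg hc (h0 x)) ?_).trans_lt (hpow n)
  exact mul_le_mul_of_nonneg_right ((div_le_iff₀ ha).1 hn.le) (h0 x)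

end YoungFunction

namespace OrliczSpace

variable {Ω : Type*} [MeasurableSpace Ω] {m : Measure Ω} {φ : YoungFunction}

theorem exists_lintegral_lt_top (g : OrliczSpace φ m) :
    ∃ a : ℝ, 0 < a ∧ ∫⁻ x, φ (a * ‖(g : Ω →ₘ[m] ℂ) x‖) ∂m < ∞ := by
  obtain ⟨a, ha, h⟩ := g.2
  exact ⟨a, ha, by simpa [orliczModular, abs_of_pos ha] using h⟩

theorem measurableSet_le_norm (g : Ω →ₘ[m] ℂ) (t : ℝ) : MeasurableSet {x | t ≤ ‖g x‖} :=
  measurableSet_le measurable_const g.stronglyMeasurable.norm.measurable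

/-- Away from its zeros, a function of finite modular is integrable. -/
theorem integrable_indicator (g : Ω →ₘ[m] ℂ) {a t : ℝ} (ha : 0 < a) (ht : 0 < t)
    (hφ : 0 < φ (a * t)) (h : ∫⁻ x, φ (a * ‖g x‖) ∂m < ∞) :
    Integrable ({x | t ≤ ‖g x‖}.indicator g) m := by
  refine ⟨g.aestronglyMeasurable.indicator (measurableSet_le_norm g t), ?_⟩
  -- Where `|g| ≥ t`, convexity puts the chord of `φ` from `0` to `a |g|` above `φ (a t)`.
  have hle : ∀ x, φ (a * t) * (ENNReal.ofReal a * ‖{x | t ≤ ‖g x‖}.indicator g x‖ₑ)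
      ≤ ENNReal.ofReal (a * t) * φ (a * ‖g x‖) := by
    intro x
    by_cases hx : t ≤ ‖g x‖
    · rw [indicator_of_mem (show x ∈ {x | t ≤ ‖g x‖} from hx), ← ofReal_norm,
        ← ENNReal.ofReal_mul ha.le, mul_comm]
      exact φ.ofReal_mul_le (by positivity) (by gcongr)
    · rw [indicator_of_notMem (show x ∉ {x | t ≤ ‖g x‖} from hx)]
      simp
  have hfin : φ (a * t) * (ENNReal.ofReal a * ∫⁻ x, ‖{x | t ≤ ‖g x‖}.indicator g x‖ₑ ∂m) < ∞ := by
    have hm : AEMeasurable (fun x => ‖{x | t ≤ ‖g x‖}.indicator g x‖ₑ) m :=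
      (g.aestronglyMeasurable.indicator (measurableSet_le_norm g t)).enorm
    rw [← lintegral_const_mul'' _ hm, ← lintegral_const_mul'' _ (hm.const_mul _)]
    refine (lintegral_mono hle).trans_lt ?_
    rw [lintegral_const_mul' _ _ ENNReal.ofReal_ne_top]
    exact ENNReal.mul_lt_top ENNReal.ofReal_lt_top h
  have ha' : ENNReal.ofReal a ≠ 0 := (ENNReal.ofReal_pos.2 ha).ne'
  change ∫⁻ x, ‖{x | t ≤ ‖g x‖}.indicator g x‖ₑ ∂m < ∞
  -- `φ (a * t)` may be infinite, so it is not divided out: an infinite integral times nonzero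
  -- factors would contradict `hfin`.
  by_contra! htop
  rw [top_le_iff.1 htop, ENNReal.mul_top ha', ENNReal.mul_top hφ.ne'] at hfin
  exact lt_irrefl _ hfin

/-- The subspace of integrable elements of an Orlicz space. -/
noncomputable def integrablePart {Ω : Type*} [MeasurableSpace Ω] (φ : YoungFunction)
    (m : Measure Ω) : Submodule ℂ (OrliczSpace φ m) :=
  (Lp.LpSubmodule ℂ ℂ 1 m).comap (OrliczSpace φ m).subtype

theorem mem_integrablePart {g : OrliczSpace φ m} :
    g ∈ integrablePart φ m ↔ (g : Ω →ₘ[m] ℂ) ∈ Lp ℂ 1 m := Iff.rfl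

/-- The part of `g` where `φ (a |g|)` is bounded away from zero is integrable by
`integrable_indicator`; the rest is bounded on a space of finite measure. -/
theorem mem_integrablePart_of_isFiniteMeasure [IsFiniteMeasure m] (g : OrliczSpace φ m) :
    g ∈ integrablePart φ m := by
  obtain ⟨a, ha, hg⟩ := exists_lintegral_lt_top g
  obtain ⟨y, hy, hy0⟩ := ((φ.tendsto_top'.eventually
    (lt_mem_nhds (show (0 : ℝ≥0∞) < ∞ from ENNReal.zero_lt_top))).and
      (eventually_gt_atTop 0)).exists
  have h1 := integrable_indicator (φ := φ) (g : Ω →ₘ[m] ℂ) ha (div_pos hy0 ha)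
    (by rwa [mul_div_cancel₀ _ ha.ne']) hg
  have h2 : Integrable ({x | y / a ≤ ‖(g : Ω →ₘ[m] ℂ) x‖}ᶜ.indicator (g : Ω →ₘ[m] ℂ)) m := by
    refine Integrable.of_bound ((g : Ω →ₘ[m] ℂ).aestronglyMeasurable.indicator
      (measurableSet_le_norm _ _).compl) (y / a) (Eventually.of_forall fun x => ?_)
    by_cases hx : y / a ≤ ‖(g : Ω →ₘ[m] ℂ) x‖
    · rw [indicator_of_notMem (by simpa using hx), norm_zero]
      positivity
    · rw [indicator_of_mem (by simpa using hx)]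
      exact (not_le.1 hx).le
  have h3 := h1.add h2
  rw [indicator_self_add_compl] at h3
  exact mem_integrablePart.2 (Lp.mem_Lp_iff_memLp.2 (memLp_one_iff_integrable.2 h3))

theorem dense_integrablePart (hφ : φ.Delta2 m) :
    Dense (integrablePart φ m : Set (OrliczSpace φ m)) := by
  rcases eq_or_ne (m univ) ∞ with hm | hm
  swap
  · have : IsFiniteMeasure m := ⟨hm.lt_top⟩
    exact fun g => subset_closure (mem_integrablePart_of_isFiniteMeasure g)
  obtain ⟨C, -, hC⟩ := hφ.2 hm
  intro g
  rw [Metric.mem_closure_iff]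
  intro ε hε
  obtain ⟨a, ha, hg⟩ := exists_lintegral_lt_top g
  have hε2 : 0 < ε / 2 := half_pos hε
  set u : Ω → ℂ := ⇑(g : Ω →ₘ[m] ℂ) with hu
  have hum : AEStronglyMeasurable u m := (g : Ω →ₘ[m] ℂ).aestronglyMeasurable
  have hS : ∀ t : ℝ, MeasurableSet {x | t ≤ ‖u x‖} := measurableSet_le_norm _
  -- The part of `u` below height `1 / (n + 1)` vanishes eventually at each point, and its modular
  -- at scale `ε / 2` is dominated by that of `u`, finite by `Δ₂`. The halved scale later turns a
  -- bound `≤ ε / 2` into a strict one.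
  have hlim : Tendsto (fun n : ℕ => ∫⁻ x,
      φ (‖{x | 1 / ((n : ℝ) + 1) ≤ ‖u x‖}ᶜ.indicator u x‖ / (ε / 2)) ∂m) atTop (𝓝 0) := by
    rw [← lintegral_zero (μ := m)]
    refine tendsto_lintegral_of_dominated_convergence' (fun x => φ ((ε / 2)⁻¹ * ‖u x‖))
      (fun n => φ.aemeasurable_comp
        ((hum.indicator (hS _).compl).norm.aemeasurable.div_const _) fun x => by positivity)
      (fun n => Eventually.of_forall fun x => φ.mono (by positivity) ?_)
      (YoungFunction.lintegral_mul_lt_top_of_le_mul hC (fun x => norm_nonneg _) ha hg (by positivity)).ne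
      (Eventually.of_forall fun x => ?_)
    · rw [div_eq_inv_mul]
      gcongr
      exact norm_indicator_le_norm_self _ _
    · refine tendsto_const_nhds.congr' ?_
      rcases eq_or_ne (u x) 0 with h0 | h0
      · refine Eventually.of_forall fun n => ?_
        beta_reduce
        rw [indicator_apply_eq_zero.2 fun _ => h0, norm_zero, zero_div, φ.map_zero]
      · filter_upwards [tendsto_one_div_add_atTop_nhds_zero_nat.eventually
          (gt_mem_nhds (norm_pos_iff.2 h0))] with n hn
        rw [indicator_of_notMem (by simpa using hn.le)]
        simp [φ.map_zero]
  obtain ⟨n, hn⟩ := (hlim.eventually (gt_mem_nhds (zero_lt_one (α := ℝ≥0∞)))).exists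
  set S := {x | 1 / ((n : ℝ) + 1) ≤ ‖u x‖} with hSdef
  have hSm : MeasurableSet S := hS _
  have hwm : AEStronglyMeasurable (S.indicator u) m := hum.indicator hSm
  have hmem : AEEqFun.mk (S.indicator u) hwm ∈ OrliczSpace φ m := by
    refine ⟨a, ha, lt_of_le_of_lt ?_ hg⟩
    refine lintegral_mono_ae ((AEEqFun.coeFn_mk _ hwm).mono fun x hx =>
      φ.mono (norm_nonneg _) ?_)
    beta_reduce
    rw [hx, norm_mul, Complex.norm_real, Real.norm_of_nonneg ha.le]
    gcongr
    exact norm_indicator_le_norm_self _ _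
  refine ⟨⟨_, hmem⟩, ?_, ?_⟩
  · refine mem_integrablePart.2 (Lp.mem_Lp_iff_memLp.2 ((memLp_congr_ae
      (AEEqFun.coeFn_mk _ hwm)).2 (memLp_one_iff_integrable.2 ?_)))
    exact integrable_indicator (φ := φ) (g : Ω →ₘ[m] ℂ) ha (by positivity)
      (YoungFunction.pos_of_le_mul hC (by positivity)) hg
  · rw [dist_eq_norm]
    refine lt_of_le_of_lt ((norm_le_iff _ hε2).2 (le_of_eq_of_le (lintegral_congr_ae ?_) hn.le))
      (half_lt_self hε)
    filter_upwards [AEEqFun.coeFn_mk _ hwm, AEEqFun.coeFn_sub (g : Ω →ₘ[m] ℂ)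
      (AEEqFun.mk (S.indicator u) hwm)] with x h1 h2
    rw [Submodule.coe_sub, h2, Pi.sub_apply, h1, ← hu]
    congr 3
    rw [indicator_compl]
    rfl

end OrliczSpace

/-! ### The convolution of `L¹(G ⧸ H)` as a vector-valued integral of translates -/

/-- A continuous function with values in a possibly nonseparable space is measurable on sets of
finite measure for a regular measure. -/
theorem aestronglyMeasurable_restrict_of_continuous {X E : Type*} [TopologicalSpace X] [T2Space X]
    [MeasurableSpace X] [BorelSpace X] {m : Measure X} [m.InnerRegularCompactLTTop]
    [TopologicalSpace E] [TopologicalSpace.PseudoMetrizableSpace E] {F : X → E} (hF : Continuous F) {s : Set X}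
    (hs : MeasurableSet s) (hms : m s ≠ ∞) : AEStronglyMeasurable F (m.restrict s) := by
  have hε : ∀ n : ℕ, ENNReal.ofReal (1 / ((n : ℝ) + 1)) ≠ 0 := fun n =>
    (ENNReal.ofReal_pos.2 (by positivity)).ne'
  -- Up to a null set, `s` is a countable union of compact sets by inner regularity, and continuity
  -- gives measurability on each of them.
  choose K hKs hKc hKm using fun n : ℕ => hs.exists_isCompact_sdiff_lt hms (hε n)
  have hnull : m (s \ ⋃ n, K n) = 0 := by
    refine le_antisymm (ge_of_tendsto' (x := atTop)
      (f := fun n : ℕ => ENNReal.ofReal (1 / ((n : ℝ) + 1))) ?_ fun n => ?_) zero_le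
    · simpa using ENNReal.tendsto_ofReal tendsto_one_div_add_atTop_nhds_zero_nat
    · exact (measure_mono (sdiff_subset_sdiff_right (subset_iUnion K n))).trans (hKm n).le
  have hae : s =ᵐ[m] ⋃ n, K n :=
    (ae_le_set.2 hnull).antisymm (iUnion_subset hKs).eventuallyLE
  rw [Measure.restrict_congr_set hae, aestronglyMeasurable_iUnion_iff]
  exact fun n => hF.continuousOn.aestronglyMeasurable_of_isCompact (hKc n) (hKc n).measurableSet

/-- Neither σ-finiteness of `m` nor separability of `E` is available. But an integrable `f` vanishes
off the union of the sets `{|f| ≥ 1 / (n + 1)}`, which have finite measure, so `F` need only be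
measurable on these. -/
theorem integrable_smul_of_continuous_of_norm_le {X E : Type*} [TopologicalSpace X] [T2Space X]
    [MeasurableSpace X] [BorelSpace X] {m : Measure X} [m.InnerRegularCompactLTTop]
    [NormedAddCommGroup E] [NormedSpace ℂ E] {f : X → ℂ} (hf : Integrable f m) {F : X → E}
    (hF : Continuous F) {K : ℝ} (hK : ∀ x, ‖F x‖ ≤ K) : Integrable (fun x => f x • F x) m := by
  have hmeas : AEStronglyMeasurable (fun x => f x • F x) m := by
    have hgm := hf.1.stronglyMeasurable_mk
    have hg := (integrable_congr hf.1.ae_eq_mk).1 hf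
    set g := hf.1.mk f
    set S : ℕ → Set X := fun n => {x | 1 / ((n : ℝ) + 1) ≤ ‖g x‖}
    have hS : ∀ n, MeasurableSet (S n) := fun n =>
      measurableSet_le measurable_const hgm.norm.measurable
    have hFS : AEStronglyMeasurable F (m.restrict (⋃ n, S n)) :=
      aestronglyMeasurable_iUnion_iff.2 fun n => aestronglyMeasurable_restrict_of_continuous hF
        (hS n) (hg.measure_norm_ge_lt_top (by positivity)).ne
    have h1 := (aestronglyMeasurable_indicator_iff (MeasurableSet.iUnion hS)).2
      (hgm.aestronglyMeasurable.smul hFS)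
    refine h1.congr ?_
    filter_upwards [hf.1.ae_eq_mk] with x hx
    rw [hx]
    by_cases hx0 : g x = 0
    · rw [indicator_apply_eq_zero.2 fun _ => by simp [hx0]]
      exact (by simp [hx0] : (0 : E) = g x • F x)
    · obtain ⟨n, hn⟩ := exists_nat_one_div_lt (norm_pos_iff.2 hx0)
      exact indicator_of_mem (mem_iUnion.2 ⟨n, hn.le⟩) _
  refine (hf.norm.mul_const K).mono' hmeas (Eventually.of_forall fun x => ?_)
  rw [norm_smul]
  gcongr
  exact hK x

namespace CosetConvolution

instance instT2SpaceQuotient {G : Type*} [Group G] [TopologicalSpace G] [IsTopologicalGroup G]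
    [T2Space G] (H : Subgroup G) [CompactSpace H] : T2Space (G ⧸ H) := by
  have hH : IsClosed (H : Set G) := (isCompact_iff_compactSpace.2 ‹CompactSpace H›).isClosed
  refine (t2Space_iff_of_isOpenQuotientMap QuotientGroup.isOpenQuotientMap_mk).2 ?_
  have : {q : G × G | (q.1 : G ⧸ H) = q.2} = (fun q : G × G => q.1⁻¹ * q.2) ⁻¹' (H : Set G) := by
    ext q
    exact QuotientGroup.eq
  rw [this]
  exact hH.preimage (by fun_prop)

variable {G : Type*} [Group G] [TopologicalSpace G] [MeasurableSpace G] [BorelSpace G]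

/-! ### Translations acting on `L¹` -/

section Translation

variable {X : Type*} [TopologicalSpace X] [MeasurableSpace X] [BorelSpace X] [MulAction G X]
  [ContinuousSMul G X] {m : Measure X} [SMulInvariantMeasure G X m]

/-- The translate `x ↦ f (c • x)` of an integrable function. -/
noncomputable def translate (c : G) : Lp ℂ 1 m →ₗᵢ[ℂ] Lp ℂ 1 m where
  toFun f := DomMulAct.mk c • f
  map_add' f g := smul_add _ f g
  map_smul' a f := smul_comm _ a f
  norm_map' f := DomMulAct.norm_smul_Lp _ f

theorem translate_apply (c : G) (f : Lp ℂ 1 m) : translate c f = DomMulAct.mk c • f := rfl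

theorem translate_coeFn (c : G) (f : Lp ℂ 1 m) : translate c f =ᵐ[m] fun x => f (c • x) :=
  DomMulAct.smul_Lp_ae_eq _ f

/-- The order is reversed because translation composes on the inside: `f ↦ f (d • ·) ↦ f (d • c •
·)`. -/
theorem translate_translate (c d : G) (f : Lp ℂ 1 m) :
    translate c (translate d f) = translate (d * c) f := by
  simp only [translate_apply, smul_smul, DomMulAct.mk_mul]

theorem continuous_translate [R1Space X] [IsLocallyFiniteMeasure m]
    [m.InnerRegularCompactLTTop] (f : Lp ℂ 1 m) : Continuous fun c : G => translate c f := by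
  have : Fact ((1 : ℝ≥0∞) ≠ ∞) := ⟨ENNReal.one_ne_top⟩
  exact (DomMulAct.continuous_mk.smul continuous_const : Continuous fun c : G =>
    DomMulAct.mk c • f)

end Translation

/-! ### Averages over `H`, orbit maps and the convolution product of `L¹` -/

variable [IsTopologicalGroup G] [T2Space G] [LocallyCompactSpace G] (H : Subgroup G) [CompactSpace H]

variable [MeasurableSpace (G ⧸ H)] [BorelSpace (G ⧸ H)] {m : Measure (G ⧸ H)} [m.Regular]
  [SMulInvariantMeasure G (G ⧸ H) m]

theorem integrable_translate (f : Lp ℂ 1 m) :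
    Integrable (fun h : H => translate (h : G) f) (normalizedHaar H) := by
  have : BorelSpace H := Subtype.borelSpace _
  exact ((continuous_translate f).comp continuous_subtype_val).integrable_of_hasCompactSupport
    (HasCompactSupport.of_compactSpace _)

/-- The average `∫_H f (h • ·) dh` of an integrable function over its `H`-translates. -/
noncomputable def average : Lp ℂ 1 m →L[ℂ] Lp ℂ 1 m :=
  LinearMap.mkContinuous
    { toFun := fun f => ∫ h : H, translate (h : G) f ∂(normalizedHaar H)
      map_add' := fun f g => by
        simp only [map_add]
        exact integral_add (integrable_translate H f) (integrable_translate H g)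
      map_smul' := fun a f => by
        simp only [map_smul]
        exact integral_smul a _ } 1 fun f => by
    refine (norm_integral_le_of_norm_le_const (C := ‖f‖)
      (Eventually.of_forall fun h => (LinearIsometry.norm_map _ f).le)).trans ?_
    simp

theorem average_apply (f : Lp ℂ 1 m) :
    average H f = ∫ h : H, translate (h : G) f ∂(normalizedHaar H) := rfl

theorem norm_average_le (f : Lp ℂ 1 m) : ‖average H f‖ ≤ ‖f‖ := by
  simpa using (LinearMap.mkContinuous_norm_le _ zero_le_one _ : ‖average H (m := m)‖ ≤ 1)
    |> (average H (m := m)).le_of_opNorm_le (x := f)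

/-- This is right invariance of `dh`, valid as `H` is compact. It makes `orbitMap` independent of
the representative of a coset. -/
theorem translate_average (k : H) (f : Lp ℂ 1 m) :
    translate (k : G) (average H f) = average H f := by
  have : BorelSpace H := Subtype.borelSpace _
  have : (normalizedHaar H).IsMulRightInvariant := ⟨normalizedHaar_map_mul_right H⟩
  have h := (translate (k : G)).toContinuousLinearMap.integral_comp_comm (integrable_translate H f)
  simp only [LinearIsometry.coe_toContinuousLinearMap, translate_translate] at h
  rw [average_apply, ← h]
  exact integral_mul_right_eq_self (fun h : H => translate (h : G) f) k

/-- The map `yH ↦ (J g) (y⁻¹ ·)` from `G ⧸ H` to `L¹`. -/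
noncomputable def orbitMap (g : Lp ℂ 1 m) : G ⧸ H → Lp ℂ 1 m :=
  Quotient.lift (fun y : G => translate y⁻¹ (average H g)) (by
    intro x y hxy
    have hk : x⁻¹ * y ∈ H := QuotientGroup.leftRel_apply.1 hxy
    have h := congrArg (translate y⁻¹) (translate_average H ⟨x⁻¹ * y, hk⟩ g)
    simpa [translate_translate] using h)

theorem orbitMap_mk (g : Lp ℂ 1 m) (y : G) :
    orbitMap H g (y : G ⧸ H) = translate y⁻¹ (average H g) := rfl

theorem orbitMap_smul (g : Lp ℂ 1 m) (c : G) (w : G ⧸ H) :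
    orbitMap H g (c • w) = translate c⁻¹ (orbitMap H g w) := by
  induction w using QuotientGroup.induction_on with
  | H y =>
    rw [orbitMap_mk, translate_translate, ← mul_inv_rev]
    rfl

theorem continuous_orbitMap (g : Lp ℂ 1 m) : Continuous (orbitMap H g) :=
  QuotientGroup.isOpenQuotientMap_mk.isQuotientMap.continuous_iff.2
    ((continuous_translate (average H g)).comp continuous_inv)

theorem norm_orbitMap_le (g : Lp ℂ 1 m) (w : G ⧸ H) : ‖orbitMap H g w‖ ≤ ‖g‖ := by
  induction w using QuotientGroup.induction_on with
  | H y =>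
    rw [orbitMap_mk, LinearIsometry.norm_map]
    exact norm_average_le H g

theorem orbitMap_add (g g' : Lp ℂ 1 m) (w : G ⧸ H) :
    orbitMap H (g + g') w = orbitMap H g w + orbitMap H g' w := by
  induction w using QuotientGroup.induction_on with
  | H y => simp only [orbitMap_mk, map_add]

theorem orbitMap_const_smul (a : ℂ) (g : Lp ℂ 1 m) (w : G ⧸ H) :
    orbitMap H (a • g) w = a • orbitMap H g w := by
  induction w using QuotientGroup.induction_on with
  | H y => simp only [orbitMap_mk, map_smul]

theorem integrable_smul_orbitMap (f g : Lp ℂ 1 m) :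
    Integrable (fun w => f w • orbitMap H g w) m :=
  integrable_smul_of_continuous_of_norm_le (L1.integrable_coeFn f) (continuous_orbitMap H g)
    (norm_orbitMap_le H g)

/-- The convolution product of `L¹(G ⧸ H)`. -/
noncomputable def convL1 : Lp ℂ 1 m →ₗ[ℂ] Lp ℂ 1 m →ₗ[ℂ] Lp ℂ 1 m :=
  LinearMap.mk₂ ℂ (fun f g => ∫ w, f w • orbitMap H g w ∂m)
    (fun f f' g => by
      rw [← integral_add (integrable_smul_orbitMap H f g) (integrable_smul_orbitMap H f' g)]
      refine integral_congr_ae ((Lp.coeFn_add f f').mono fun w hw => ?_)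
      simp only [hw, Pi.add_apply, add_smul])
    (fun a f g => by
      rw [← integral_smul]
      refine integral_congr_ae ((Lp.coeFn_smul a f).mono fun w hw => ?_)
      simp only [hw, Pi.smul_apply, smul_assoc])
    (fun f g g' => by
      rw [← integral_add (integrable_smul_orbitMap H f g) (integrable_smul_orbitMap H f g')]
      simp only [orbitMap_add, smul_add])
    (fun a f g => by
      rw [← integral_smul]
      simp only [orbitMap_const_smul, smul_comm a])

theorem convL1_apply (f g : Lp ℂ 1 m) : convL1 H f g = ∫ w, f w • orbitMap H g w ∂m := rfl

theorem norm_convL1_le (f g : Lp ℂ 1 m) : ‖convL1 H f g‖ ≤ ‖f‖ * ‖g‖ := by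
  rw [convL1_apply, L1.norm_eq_integral_norm f, ← integral_mul_const]
  refine norm_integral_le_of_norm_le ((L1.integrable_coeFn f).norm.mul_const _)
    (Eventually.of_forall fun w => ?_)
  rw [norm_smul]
  gcongr
  exact norm_orbitMap_le H g w

/-- Substitute `w ↦ c • w` in the integral, using invariance of `m`: the factor `translate c⁻¹`
produced by `orbitMap_smul` cancels `translate c`. -/
theorem translate_convL1 (c : G) (f g : Lp ℂ 1 m) :
    translate c (convL1 H f g) = convL1 H (translate c f) g := by
  have h := (translate (m := m) c).toContinuousLinearMap.integral_comp_comm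
    (integrable_smul_orbitMap H f g)
  simp only [LinearIsometry.coe_toContinuousLinearMap, map_smul] at h
  rw [convL1_apply, ← h, convL1_apply]
  have h2 := (measurePreserving_smul c m).integral_comp (measurableEmbedding_const_smul c)
    (fun w => f w • translate c (orbitMap H g w))
  rw [← h2]
  refine integral_congr_ae ((translate_coeFn c f).mono fun w hw => ?_)
  simp only [hw, orbitMap_smul, translate_translate, inv_mul_cancel]
  congr 1
  rw [translate_apply, DomMulAct.mk_one, one_smul]

/-- A bounded operator which commutes with translations is a module map. -/
theorem map_convL1 (T : Lp ℂ 1 m →L[ℂ] Lp ℂ 1 m)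
    (hT : ∀ (c : G) (f : Lp ℂ 1 m), T (translate c f) = translate c (T f)) (f g : Lp ℂ 1 m) :
    T (convL1 H f g) = convL1 H f (T g) := by
  have havg : T (average H g) = average H (T g) := by
    rw [average_apply, ← T.integral_comp_comm (integrable_translate H g), average_apply]
    simp only [hT]
  have horb : ∀ w, T (orbitMap H g w) = orbitMap H (T g) w := by
    intro w
    induction w using QuotientGroup.induction_on with
    | H y => rw [orbitMap_mk, orbitMap_mk, hT, havg]
  rw [convL1_apply, ← T.integral_comp_comm (integrable_smul_orbitMap H f g), convL1_apply]
  simp only [map_smul, horb]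

theorem convL1_assoc (f g k : Lp ℂ 1 m) :
    convL1 H (convL1 H f g) k = convL1 H f (convL1 H g k) := by
  -- The operator is right convolution by `k`, which commutes with translations by
  -- `translate_convL1`.
  have h := map_convL1 H (LinearMap.mkContinuous ((convL1 H).flip k) ‖k‖ fun f => by
    rw [mul_comm]
    exact norm_convL1_le H f k) (fun c f => (translate_convL1 H c f k).symm) f g
  exact h

variable (m) in
theorem isBanachAlgebraProduct_convL1 :
    IsBanachAlgebraProduct (convL1 H : Lp ℂ 1 m →ₗ[ℂ] Lp ℂ 1 m →ₗ[ℂ] Lp ℂ 1 m) :=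
  ⟨inferInstance, convL1_assoc H, norm_convL1_le H⟩

end CosetConvolution

/-! ### The Luxemburg norm of a convolution of integrable functions -/

/-- Divide by `c = ∫ |f|`: the integral becomes `c` times the mean, for the probability density `|f|
/ c`, of the phase of `f` times `F`. Balancedness absorbs the phase (read as `0` where `f = 0`), and
a closed convex set contains its means. -/
theorem Convex.exists_integral_smul_eq {X E : Type*} [MeasurableSpace X] {m : Measure X}
    [NormedAddCommGroup E] [NormedSpace ℝ E] [NormedSpace ℂ E] [IsScalarTower ℝ ℂ E]
    [CompleteSpace E] {C : Set E} (hC : Convex ℝ C)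
    (hcl : IsClosed C) (hbal : ∀ (c : ℂ) (x : E), ‖c‖ ≤ 1 → x ∈ C → c • x ∈ C)
    (hne : C.Nonempty) {f : X → ℂ} (hf : Integrable f m) {F : X → E} (hF : ∀ x, F x ∈ C)
    (hint : Integrable (fun x => f x • F x) m) :
    ∃ u ∈ C, ∫ x, f x • F x ∂m = (∫ x, ‖f x‖ ∂m) • u := by
  rcases (integral_nonneg fun x => norm_nonneg (f x) : 0 ≤ ∫ x, ‖f x‖ ∂m).eq_or_lt with h0 | hpos
  · obtain ⟨u, hu⟩ := hne
    refine ⟨u, hu, ?_⟩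
    rw [← h0, zero_smul]
    have := (integral_eq_zero_iff_of_nonneg (fun x => norm_nonneg (f x)) hf.norm).1 h0.symm
    refine integral_eq_zero_of_ae (this.mono fun x hx => ?_)
    have hx' : f x = 0 := norm_eq_zero.1 hx
    simp [hx']
  set c := ∫ x, ‖f x‖ ∂m with hc
  set ρ : X → ℝ≥0 := fun x => ‖f x‖₊ / c.toNNReal with hρ
  have hρm : AEMeasurable ρ m := hf.1.nnnorm.aemeasurable.div_const _
  have hρc : ∀ x, (ρ x : ℝ) = ‖f x‖ / c := fun x => by simp [hρ, Real.coe_toNNReal c hpos.le]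
  have hsm : ∀ x, ρ x • ((f x / ‖f x‖ : ℂ) • F x) = c⁻¹ • (f x • F x) := by
    intro x
    have hcoe : ∀ (r : ℝ) (y : E), r • y = (r : ℂ) • y := fun r y => (algebraMap_smul ℂ r y).symm
    rw [NNReal.smul_def, hρc, hcoe, hcoe, smul_smul, smul_smul]
    congr 1
    rcases eq_or_ne (f x) 0 with h | h
    · simp [h]
    · have h1 : (‖f x‖ : ℂ) ≠ 0 := by exact_mod_cast norm_ne_zero_iff.2 h
      have h2 : (c : ℂ) ≠ 0 := by exact_mod_cast hpos.ne'
      push_cast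
      field_simp
  have hprob : IsProbabilityMeasure (m.withDensity fun x => (ρ x : ℝ≥0∞)) := by
    refine ⟨?_⟩
    rw [withDensity_apply _ MeasurableSet.univ, Measure.restrict_univ]
    have : ∀ x, (ρ x : ℝ≥0∞) = ENNReal.ofReal (‖f x‖ / c) := fun x => by
      rw [← hρc, ENNReal.ofReal_coe_nnreal]
    simp only [this]
    rw [← ofReal_integral_eq_lintegral_ofReal (hf.norm.div_const c)
      (Eventually.of_forall fun x => by positivity), integral_div, ← hc, div_self hpos.ne',
      ENNReal.ofReal_one]
  refine ⟨∫ x, (f x / ‖f x‖ : ℂ) • F x ∂(m.withDensity fun x => (ρ x : ℝ≥0∞)), ?_, ?_⟩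
  · refine hC.integral_mem hcl (Eventually.of_forall fun x => hbal _ _ ?_ (hF x)) ?_
    · rw [norm_div, Complex.norm_real, norm_norm]
      exact div_self_le_one _
    · rw [integrable_withDensity_iff_integrable_smul₀ hρm]
      simp only [hsm]
      exact hint.smul _
  · rw [integral_withDensity_eq_integral_smul₀ hρm]
    simp only [hsm]
    rw [integral_smul, smul_smul, mul_inv_cancel₀ hpos.ne', one_smul]

section ModularBall

variable {Ω : Type*} [MeasurableSpace Ω] (φ : YoungFunction) (m : Measure Ω)

/-- The integrable functions of Luxemburg norm at most `k`. -/
def modularBall (k : ℝ) : Set (Lp ℂ 1 m) := {u | ∫⁻ x, φ (‖u x‖ / k) ∂m ≤ 1}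

variable {m} {k : ℝ}

theorem zero_mem_modularBall : (0 : Lp ℂ 1 m) ∈ modularBall φ m k := by
  change ∫⁻ x, φ (‖(0 : Lp ℂ 1 m) x‖ / k) ∂m ≤ 1
  rw [lintegral_congr_ae (g := fun _ => 0) ((Lp.coeFn_zero ℂ 1 m).mono fun x hx => by
    beta_reduce
    rw [hx, Pi.zero_apply, norm_zero, zero_div, φ.map_zero])]
  simp

theorem convex_modularBall (hk : 0 < k) : Convex ℝ (modularBall φ m k) := by
  intro u hu v hv a b ha hb hab
  have e : ∀ w : Lp ℂ 1 m, ∫⁻ x, φ (k⁻¹ * ‖w x‖) ∂m = ∫⁻ x, φ (‖w x‖ / k) ∂m := fun w => by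
    simp only [inv_mul_eq_div]
  refine (orlicz_lintegral_convex_le φ (u := u) (v := v) (s := k⁻¹) (t := k⁻¹)
    (Lp.aestronglyMeasurable u) ha hb hab (by positivity) _ (fun x => by positivity) ?_).trans ?_
  · filter_upwards [Lp.coeFn_add (a • u) (b • v), Lp.coeFn_smul a u, Lp.coeFn_smul b v]
      with x h1 h2 h3
    rw [h1, Pi.add_apply, h2, h3, Pi.smul_apply, Pi.smul_apply]
    refine (div_le_div_of_nonneg_right (norm_add_le _ _) hk.le).trans (le_of_eq ?_)
    rw [norm_smul, norm_smul, Real.norm_of_nonneg ha, Real.norm_of_nonneg hb]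
    field_simp
  · rw [e, e]
    calc _ ≤ ENNReal.ofReal a * 1 + ENNReal.ofReal b * 1 := by gcongr <;> assumption
      _ = 1 := by rw [mul_one, mul_one, ← ENNReal.ofReal_add ha hb, hab, ENNReal.ofReal_one]

/-- An `L¹`-convergent sequence has an almost everywhere convergent subsequence, to which Fatou's
lemma applies. -/
theorem isClosed_modularBall (hk : 0 < k) : IsClosed (modularBall φ m k) := by
  refine IsSeqClosed.isClosed fun u v hu huv => ?_
  obtain ⟨ns, -, hns⟩ := (tendstoInMeasure_of_tendsto_Lp huv).exists_seq_tendsto_ae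
  exact φ.lintegral_le_of_tendsto (u := fun n x => ‖u (ns n) x‖ / k)
    (fun n => (Lp.aestronglyMeasurable _).norm.aemeasurable.div_const _)
    (fun n x => by positivity) (hns.mono fun x hx => hx.norm.div_const k) fun n => hu (ns n)

theorem smul_mem_modularBall (hk : 0 < k) (c : ℂ) (u : Lp ℂ 1 m) (hc : ‖c‖ ≤ 1)
    (hu : u ∈ modularBall φ m k) : c • u ∈ modularBall φ m k := by
  refine le_trans (lintegral_mono_ae ((Lp.coeFn_smul c u).mono fun x hx =>
    φ.mono (by positivity) ?_)) hu
  rw [hx, Pi.smul_apply, norm_smul]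
  gcongr
  exact mul_le_of_le_one_left (norm_nonneg _) hc

end ModularBall

namespace CosetConvolution

variable {G : Type*} [Group G] [TopologicalSpace G] [MeasurableSpace G] [BorelSpace G]

theorem translate_mem_modularBall {X : Type*} [TopologicalSpace X] [MeasurableSpace X]
    [BorelSpace X] [MulAction G X] [ContinuousSMul G X] {m : Measure X}
    [SMulInvariantMeasure G X m] (φ : YoungFunction) {k : ℝ} (c : G) {u : Lp ℂ 1 m}
    (hu : u ∈ modularBall φ m k) : translate c u ∈ modularBall φ m k := by
  refine le_of_eq_of_le ?_ (show ∫⁻ x, φ (‖u x‖ / k) ∂m ≤ 1 from hu)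
  rw [← (measurePreserving_smul c m).lintegral_comp_emb (measurableEmbedding_const_smul c)
    fun x => φ (‖u x‖ / k)]
  exact lintegral_congr_ae ((translate_coeFn c u).mono fun x hx => by simp only [hx])

variable [IsTopologicalGroup G] [T2Space G] [LocallyCompactSpace G] (H : Subgroup G)
  [CompactSpace H] [MeasurableSpace (G ⧸ H)] [BorelSpace (G ⧸ H)] {m : Measure (G ⧸ H)} [m.Regular]
  [SMulInvariantMeasure G (G ⧸ H) m] (φ : YoungFunction) {k : ℝ}

theorem orbitMap_mem_modularBall (hk : 0 < k) {g : Lp ℂ 1 m} (hg : g ∈ modularBall φ m k)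
    (w : G ⧸ H) : orbitMap H g w ∈ modularBall φ m k := by
  induction w using QuotientGroup.induction_on with
  | H y =>
    refine translate_mem_modularBall φ _ ?_
    exact (convex_modularBall φ hk).integral_mem (isClosed_modularBall φ hk)
      (Eventually.of_forall fun h => translate_mem_modularBall φ _ hg) (integrable_translate H g)

theorem convL1_mem_modularBall (hk : 0 < k) {f g : Lp ℂ 1 m} (hf : f ≠ 0)
    (hg : g ∈ modularBall φ m k) : convL1 H f g ∈ modularBall φ m (‖f‖ * k) := by
  obtain ⟨u, hu, hfu⟩ := (convex_modularBall φ hk).exists_integral_smul_eq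
    (isClosed_modularBall φ hk) (smul_mem_modularBall φ hk) ⟨0, zero_mem_modularBall φ⟩
    (L1.integrable_coeFn f) (orbitMap_mem_modularBall H φ hk hg) (integrable_smul_orbitMap H f g)
  rw [convL1_apply, hfu, ← L1.norm_eq_integral_norm]
  have hf' : 0 < ‖f‖ := norm_pos_iff.2 hf
  refine le_of_eq_of_le (lintegral_congr_ae ?_) (show ∫⁻ x, φ (‖u x‖ / k) ∂m ≤ 1 from hu)
  refine (Lp.coeFn_smul ‖f‖ u).mono fun x hx => ?_
  beta_reduce
  rw [hx, Pi.smul_apply, norm_smul, norm_norm, mul_div_mul_left _ _ hf'.ne']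

end CosetConvolution

/-! ### Convolution of continuous functions with compact support -/

/-- The Bochner integral in `L¹` of a compactly supported continuous family of functions is given
by the pointwise integral. -/
theorem coeFn_integral_ae_eq_of_hasCompactSupport {T X : Type*} [TopologicalSpace T]
    [MeasurableSpace T] [OpensMeasurableSpace T] [TopologicalSpace X] [T2Space X]
    [MeasurableSpace X] [BorelSpace X] {ν : Measure T} [IsFiniteMeasureOnCompacts ν]
    {m : Measure X} [IsFiniteMeasureOnCompacts m] {k : T → X → ℂ}
    (hk : Continuous (Function.uncurry k)) (hks : HasCompactSupport (Function.uncurry k))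
    {Φ : T → Lp ℂ 1 m} (hΦ : Integrable Φ ν) (hΦk : ∀ t, Φ t =ᵐ[m] k t) :
    (∫ t, Φ t ∂ν : Lp ℂ 1 m) =ᵐ[m] fun x => ∫ t, k t x ∂ν := by
  have hA : IsCompact (Prod.fst '' tsupport (Function.uncurry k)) :=
    hks.isCompact.image continuous_fst
  have hB : IsCompact (Prod.snd '' tsupport (Function.uncurry k)) :=
    hks.isCompact.image continuous_snd
  have hzero : ∀ t x, (t, x) ∉ tsupport (Function.uncurry k) → k t x = 0 := fun t x h =>
    image_eq_zero_of_notMem_tsupport (f := Function.uncurry k) h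
  have hcont : Continuous fun x => ∫ t, k t x ∂ν := by
    rw [← continuousOn_univ]
    refine continuousOn_integral_of_compact_support (f := fun x t => k t x) hA
      (hk.comp continuous_swap).continuousOn fun x t _ ht => hzero t x fun h => ht ⟨_, h, rfl⟩
  have hcs : HasCompactSupport fun x => ∫ t, k t x ∂ν := by
    refine HasCompactSupport.intro hB fun x hx => ?_
    have : ∀ t, k t x = 0 := fun t => hzero t x fun h => hx ⟨_, h, rfl⟩
    simp [this]
  -- Both sides are integrable, so their integrals over sets `s` determine them. Integration over
  -- `s` is a bounded functional on `L¹`, hence passes inside the Bochner integral; Fubini for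
  -- continuous compactly supported kernels then finishes without σ-finiteness.
  refine Integrable.ae_eq_of_forall_setIntegral_eq _ _ (L1.integrable_coeFn _)
    (hcont.integrable_of_hasCompactSupport hcs) fun s hs _ => ?_
  let L : Lp ℂ 1 m →L[ℂ] ℂ := LinearMap.mkContinuous
    { toFun := fun f => ∫ x in s, f x ∂m
      map_add' := fun f g => by
        rw [← integral_add (L1.integrable_coeFn f).integrableOn (L1.integrable_coeFn g).integrableOn]
        exact integral_congr_ae (ae_restrict_of_ae (Lp.coeFn_add f g))
      map_smul' := fun a f => by
        rw [RingHom.id_apply, ← integral_smul]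
        exact integral_congr_ae (ae_restrict_of_ae (Lp.coeFn_smul a f)) } 1 fun f => by
    rw [one_mul, L1.norm_eq_integral_norm]
    exact (norm_integral_le_integral_norm _).trans (setIntegral_le_integral
      (L1.integrable_coeFn f).norm (Eventually.of_forall fun x => norm_nonneg _))
  have hL : ∀ f, L f = ∫ x in s, f x ∂m := fun f => rfl
  have : IsFiniteMeasureOnCompacts (m.restrict s) :=
    ⟨fun K hK => (Measure.restrict_apply_le s K).trans_lt hK.measure_lt_top⟩
  rw [← hL, ← L.integral_comp_comm hΦ, ← integral_integral_swap_of_hasCompactSupport hk hks]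
  refine integral_congr_ae (Eventually.of_forall fun t => ?_)
  exact integral_congr_ae (ae_restrict_of_ae (hΦk t))

namespace CosetConvolution

variable {G : Type*} [Group G] [TopologicalSpace G] [IsTopologicalGroup G] [MeasurableSpace G]
  [BorelSpace G] (H : Subgroup G) [CompactSpace H]

theorem continuous_leftAverage {g : G ⧸ H → ℂ} (hg : Continuous g) :
    Continuous (leftAverage H g) := by
  have : BorelSpace H := Subtype.borelSpace _
  rw [← continuousOn_univ]
  refine continuousOn_integral_of_compact_support (f := fun z (h : H) => g ((h : G) • z))
    isCompact_univ (Continuous.continuousOn ?_) fun _ _ _ h => absurd (mem_univ _) h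
  exact hg.comp ((continuous_subtype_val.comp continuous_snd).smul continuous_fst)

theorem convKernel_mk (g : G ⧸ H → ℂ) (y : G) (z : G ⧸ H) :
    convKernel H g (y : G ⧸ H) z = leftAverage H g (y⁻¹ • z) := rfl

/-- Because `G → G ⧸ H` is open, its product with the identity of `G ⧸ H` is still a quotient map,
so continuity can be tested on representatives `y`. -/
theorem continuous_convKernel {g : G ⧸ H → ℂ} (hg : Continuous g) :
    Continuous (Function.uncurry (convKernel H g)) := by
  rw [(QuotientGroup.isOpenQuotientMap_mk.prodMap (IsOpenQuotientMap.id (X :=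
    G ⧸ H))).isQuotientMap.continuous_iff]
  exact (continuous_leftAverage H hg).comp (continuous_fst.inv.smul continuous_snd)

theorem integrable_leftAverage {g : G ⧸ H → ℂ} (hg : Continuous g) (z : G ⧸ H) :
    Integrable (fun h : H => g ((h : G) • z)) (normalizedHaar H) := by
  have : BorelSpace H := Subtype.borelSpace _
  exact (hg.comp (continuous_subtype_val.smul continuous_const)).integrable_of_hasCompactSupport
    (HasCompactSupport.of_compactSpace _)

theorem convKernel_add {g g' : G ⧸ H → ℂ} (hg : Continuous g) (hg' : Continuous g')
    (w z : G ⧸ H) : convKernel H (g + g') w z = convKernel H g w z + convKernel H g' w z := by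
  induction w using QuotientGroup.induction_on with
  | H y => exact integral_add (integrable_leftAverage H hg _) (integrable_leftAverage H hg' _)

theorem convKernel_smul (a : ℂ) (g : G ⧸ H → ℂ) (w z : G ⧸ H) :
    convKernel H (a • g) w z = a • convKernel H g w z := by
  induction w using QuotientGroup.induction_on with
  | H y => exact integral_smul a _

/-- The supports of the functions `h ↦ g (h • ·)`, `h ∈ H`, lie in a common compact set. -/
theorem hasCompactSupport_smul {G : Type*} [Group G] [TopologicalSpace G]
    [IsTopologicalGroup G] [T2Space G] (H : Subgroup G) [CompactSpace H] {g : G ⧸ H → ℂ} (hg : HasCompactSupport g) :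
    HasCompactSupport (Function.uncurry fun (h : H) z => g ((h : G) • z)) := by
  have hK : IsCompact ((fun p : H × (G ⧸ H) => (p.1, (p.1⁻¹ : G) • p.2)) ''
      (univ ×ˢ tsupport g)) := (isCompact_univ.prod hg.isCompact).image (by fun_prop)
  refine HasCompactSupport.of_support_subset_isCompact hK ?_
  rintro ⟨h, z⟩ hz
  exact ⟨(h, (h : G) • z), ⟨mem_univ _, subset_tsupport g hz⟩, by simp⟩

/-- Images of interiors of compact neighbourhoods are open and cover `K`; finitely many suffice. The
compact lift is used to bound supports in `hasCompactSupport_mul_convKernel`. -/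
theorem exists_isCompact_subset_image_mk {G : Type*} [Group G] [TopologicalSpace G]
    [IsTopologicalGroup G] [LocallyCompactSpace G] (H : Subgroup G) {K : Set (G ⧸ H)} (hK : IsCompact K) :
    ∃ L : Set G, IsCompact L ∧ K ⊆ (QuotientGroup.mk : G → G ⧸ H) '' L := by
  choose N hNc hN using fun x : G => exists_compact_mem_nhds x
  have hopen : ∀ x : G, IsOpen ((QuotientGroup.mk : G → G ⧸ H) '' interior (N x)) := fun x =>
    QuotientGroup.isOpenMap_coe _ isOpen_interior
  obtain ⟨t, ht⟩ := hK.elim_finite_subcover _ hopen fun z _ => by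
    induction z using QuotientGroup.induction_on with
    | H x => exact mem_iUnion.2 ⟨x, x, mem_interior_iff_mem_nhds.2 (hN x), rfl⟩
  refine ⟨⋃ x ∈ t, N x, t.isCompact_biUnion fun x _ => hNc x, ht.trans ?_⟩
  rw [image_iUnion₂]
  exact iUnion₂_mono fun x _ => image_mono interior_subset

theorem continuous_mul_convKernel {f g : G ⧸ H → ℂ} (hf : Continuous f) (hg : Continuous g) :
    Continuous (Function.uncurry fun w z => f w * convKernel H g w z) :=
  (hf.comp continuous_fst).mul (continuous_convKernel H hg)

section

variable [MeasurableSpace (G ⧸ H)] [OpensMeasurableSpace (G ⧸ H)] (m : Measure (G ⧸ H))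
  [IsFiniteMeasureOnCompacts m]

theorem integrable_mul_convKernel (f g : C_c(G ⧸ H, ℂ)) (z : G ⧸ H) :
    Integrable (fun w => f w * convKernel H g w z) m := by
  refine Continuous.integrable_of_hasCompactSupport
    (f.continuous.mul ((continuous_convKernel H g.continuous).comp
      (continuous_id.prodMk continuous_const))) f.hasCompactSupport.mul_right

theorem continuous_cosetConv
    (f g : C_c(G ⧸ H, ℂ)) : Continuous (cosetConv H m f g) := by
  have hc : Continuous (Function.uncurry fun z w => f w * convKernel H g w z) :=
    (continuous_mul_convKernel H f.continuous g.continuous).comp continuous_swap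
  rw [← continuousOn_univ]
  exact continuousOn_integral_of_compact_support (f := fun z w => f w * convKernel H g w z)
    f.hasCompactSupport.isCompact hc.continuousOn fun z w _ hw => by
      rw [image_eq_zero_of_notMem_tsupport hw, zero_mul]

end

variable [T2Space G] [LocallyCompactSpace G]

/-- If the kernel is nonzero at `(yH, z)`, some `h • y⁻¹ • z` lies in the support of `g`, so `z = y
• h⁻¹ • v` with `y`, `h`, `v` all in compact sets. -/
theorem hasCompactSupport_mul_convKernel {f g : G ⧸ H → ℂ} (hf : HasCompactSupport f)
    (hg : HasCompactSupport g) :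
    HasCompactSupport (Function.uncurry fun w z => f w * convKernel H g w z) := by
  obtain ⟨L, hL, hfL⟩ := exists_isCompact_subset_image_mk H hf.isCompact
  have hK : IsCompact ((fun p : G × H × (G ⧸ H) => ((p.1 : G ⧸ H), p.1 • (p.2.1⁻¹ : G) • p.2.2)) ''
      (L ×ˢ univ ×ˢ tsupport g)) := by
    refine (hL.prod (isCompact_univ.prod hg.isCompact)).image ?_
    exact (QuotientGroup.continuous_mk.comp continuous_fst).prodMk (by fun_prop)
  refine HasCompactSupport.of_support_subset_isCompact hK ?_
  rintro ⟨w, z⟩ hwz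
  obtain ⟨hw, hz⟩ := mul_ne_zero_iff.1 (show f w * convKernel H g w z ≠ 0 from hwz)
  obtain ⟨y, hy, rfl⟩ := hfL (subset_tsupport f hw)
  obtain ⟨h, hh⟩ : ∃ h : H, g ((h : G) • y⁻¹ • z) ≠ 0 := by
    by_contra! hcon
    refine hz ?_
    rw [convKernel_mk, leftAverage]
    simp [hcon]
  exact ⟨(y, h, (h : G) • y⁻¹ • z), ⟨hy, mem_univ _, subset_tsupport g hh⟩, by simp⟩

variable [MeasurableSpace (G ⧸ H)]

theorem hasCompactSupport_cosetConv (m : Measure (G ⧸ H)) (f g : C_c(G ⧸ H, ℂ)) :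
    HasCompactSupport (cosetConv H m f g) := by
  have h := hasCompactSupport_mul_convKernel H f.hasCompactSupport g.hasCompactSupport
  refine HasCompactSupport.intro (h.isCompact.image continuous_snd) fun z hz => ?_
  have : ∀ w, f w * convKernel H g w z = 0 := fun w =>
    image_eq_zero_of_notMem_tsupport (f := Function.uncurry fun w z =>
      f w * convKernel H g w z) (x := (w, z)) fun h => hz ⟨_, h, rfl⟩
  simp [cosetConv, this]

variable [BorelSpace (G ⧸ H)]

/-- The convolution of compactly supported continuous functions on `G ⧸ H`. -/
noncomputable def convCc (m : Measure (G ⧸ H)) [IsFiniteMeasureOnCompacts m] :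
    C_c(G ⧸ H, ℂ) →ₗ[ℂ] C_c(G ⧸ H, ℂ) →ₗ[ℂ] C_c(G ⧸ H, ℂ) :=
  LinearMap.mk₂ ℂ
    (fun f g => ⟨⟨cosetConv H m f g, continuous_cosetConv H m f g⟩,
      hasCompactSupport_cosetConv H m f g⟩)
    (fun f f' g => by
      ext z
      change ∫ w, (f w + f' w) * convKernel H g w z ∂m = _
      simp only [add_mul]
      exact integral_add (integrable_mul_convKernel H m f g z)
        (integrable_mul_convKernel H m f' g z))
    (fun a f g => by
      ext z
      change ∫ w, (a * f w) * convKernel H g w z ∂m = _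
      simp only [mul_assoc]
      exact integral_const_mul a _)
    (fun f g g' => by
      ext z
      refine (integral_congr_ae (Eventually.of_forall fun w => ?_)).trans
        (integral_add (integrable_mul_convKernel H m f g z) (integrable_mul_convKernel H m f g' z))
      exact (congrArg (f w * ·) (convKernel_add H g.continuous g'.continuous w z)).trans
        (mul_add _ _ _))
    (fun a f g => by
      ext z
      refine (integral_congr_ae (Eventually.of_forall fun w => ?_)).trans
        (integral_const_mul a fun w => f w * convKernel H g w z)
      exact (congrArg (f w * ·) (convKernel_smul H a g w z)).trans (mul_left_comm _ _ _))

theorem convCc_apply (m : Measure (G ⧸ H)) [IsFiniteMeasureOnCompacts m] (f g : C_c(G ⧸ H, ℂ)) (z : G ⧸ H) :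
    convCc H m f g z = cosetConv H m f g z := rfl

/-! ### Agreement of the `C_c` convolution with the product of `L¹` -/

variable {m : Measure (G ⧸ H)} [m.Regular] [SMulInvariantMeasure G (G ⧸ H) m]

theorem ccToL1_coeFn {Ω : Type*} [TopologicalSpace Ω] [MeasurableSpace Ω] [BorelSpace Ω]
    (m : Measure Ω) [IsFiniteMeasureOnCompacts m] (f : C_c(Ω, ℂ)) : ccToL1 m f =ᵐ[m] f :=
  MemLp.coeFn_toLp _

theorem average_ccToL1 (g : C_c(G ⧸ H, ℂ)) :
    average H (ccToL1 m g) =ᵐ[m] leftAverage H g := by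
  have : BorelSpace H := Subtype.borelSpace _
  refine coeFn_integral_ae_eq_of_hasCompactSupport (k := fun (h : H) z => g ((h : G) • z))
    (g.continuous.comp (by fun_prop)) (hasCompactSupport_smul H g.hasCompactSupport)
    (integrable_translate H _) fun h => ?_
  exact (translate_coeFn (h : G) _).trans
    ((measurePreserving_smul (h : G) m).quasiMeasurePreserving.ae (ccToL1_coeFn m g))

theorem orbitMap_ccToL1 (g : C_c(G ⧸ H, ℂ)) (w : G ⧸ H) :
    orbitMap H (ccToL1 m g) w =ᵐ[m] convKernel H g w := by
  induction w using QuotientGroup.induction_on with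
  | H y =>
    exact (translate_coeFn y⁻¹ _).trans
      ((measurePreserving_smul y⁻¹ m).quasiMeasurePreserving.ae (average_ccToL1 H g))

theorem convL1_ccToL1 (f g : C_c(G ⧸ H, ℂ)) :
    convL1 H (ccToL1 m f) (ccToL1 m g) = ccToL1 m (convCc H m f g) := by
  have hae := ccToL1_coeFn m f
  -- The class of `f` is replaced by `f` itself, since the comparison of integrals needs a
  -- continuous kernel that represents the integrand for every `w`.
  have e : convL1 H (ccToL1 m f) (ccToL1 m g) = ∫ w, f w • orbitMap H (ccToL1 m g) w ∂m :=
    integral_congr_ae (hae.mono fun w hw => by simp only [hw])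
  have hint : Integrable (fun w => f w • orbitMap H (ccToL1 m g) w) m :=
    (integrable_smul_orbitMap H (ccToL1 m f) (ccToL1 m g)).congr
      (hae.mono fun w hw => by simp only [hw])
  refine Lp.ext ?_
  rw [e]
  refine EventuallyEq.trans ?_ (ccToL1_coeFn m (convCc H m f g)).symm
  refine coeFn_integral_ae_eq_of_hasCompactSupport (k := fun w z => f w * convKernel H g w z)
    (continuous_mul_convKernel H f.continuous g.continuous)
    (hasCompactSupport_mul_convKernel H f.hasCompactSupport g.hasCompactSupport) hint fun w => ?_
  filter_upwards [Lp.coeFn_smul (f w) (orbitMap H (ccToL1 m g) w), orbitMap_ccToL1 H g w]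
    with z h1 h2
  rw [h1, Pi.smul_apply, h2, smul_eq_mul]

end CosetConvolution

/-! ### The action of `L¹(G ⧸ H)` on an Orlicz space -/

namespace CosetConvolution

open OrliczSpace

/-- The `L¹` class of an integrable element of an Orlicz space. -/
noncomputable def partToL1 {Ω : Type*} [MeasurableSpace Ω] {m : Measure Ω} {φ : YoungFunction} :
    integrablePart φ m →ₗ[ℂ] Lp ℂ 1 m where
  toFun g := ⟨((g : OrliczSpace φ m) : Ω →ₘ[m] ℂ), g.2⟩
  map_add' _ _ := rfl
  map_smul' _ _ := rfl

theorem partToL1_mem_modularBall {Ω : Type*} [MeasurableSpace Ω] {m : Measure Ω}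
    {φ : YoungFunction} (g : integrablePart φ m) {k : ℝ} (hk : 0 < k)
    (hg : ‖(g : OrliczSpace φ m)‖ ≤ k) : partToL1 g ∈ modularBall φ m k :=
  (norm_le_iff _ hk).1 hg

variable {G : Type*} [Group G] [TopologicalSpace G] [IsTopologicalGroup G] [MeasurableSpace G]
  [BorelSpace G] [T2Space G] [LocallyCompactSpace G] (H : Subgroup G) [CompactSpace H]
  [MeasurableSpace (G ⧸ H)] [BorelSpace (G ⧸ H)] {m : Measure (G ⧸ H)} [m.Regular]
  [SMulInvariantMeasure G (G ⧸ H) m] {φ : YoungFunction}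

theorem convL1_partToL1_mem (f : Lp ℂ 1 m) (g : integrablePart φ m) :
    (convL1 H f (partToL1 g) : (G ⧸ H) →ₘ[m] ℂ) ∈ OrliczSpace φ m := by
  rcases eq_or_ne f 0 with rfl | hf
  · rw [map_zero]
    exact zero_mem _
  have hk : 0 < ‖(g : OrliczSpace φ m)‖ + 1 := by positivity
  exact mem_of_lintegral_le_one (mul_pos (norm_pos_iff.2 hf) hk) (convL1_mem_modularBall H φ hk hf
    (partToL1_mem_modularBall g hk (le_add_of_nonneg_right zero_le_one)))

/-- The convolution of an integrable function with an integrable element of an Orlicz space. -/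
noncomputable def convPart :
    integrablePart φ m →ₗ[ℂ] Lp ℂ 1 m →ₗ[ℂ] OrliczSpace φ m :=
  LinearMap.mk₂ ℂ (fun g f => ⟨convL1 H f (partToL1 g), convL1_partToL1_mem H f g⟩)
    (fun g g' f => Subtype.ext (by simp only [map_add]; rfl))
    (fun a g f => Subtype.ext (by simp only [map_smul]; rfl))
    (fun g f f' => Subtype.ext (by simp only [map_add]; rfl))
    (fun a g f => Subtype.ext (by simp only [map_smul]; rfl))

theorem norm_convPart_le (g : integrablePart φ m) (f : Lp ℂ 1 m) :
    ‖convPart H g f‖ ≤ ‖g‖ * ‖f‖ := by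
  rcases eq_or_ne f 0 with rfl | hf
  · simp
  have hf' : 0 < ‖f‖ := norm_pos_iff.2 hf
  rw [← div_le_iff₀ hf']
  -- Working with every `k > ‖g‖` keeps the radius positive even if `‖g‖ = 0`.
  refine le_of_forall_gt_imp_ge_of_dense fun k hk => ?_
  have hk0 : 0 < k := (norm_nonneg _).trans_lt hk
  rw [div_le_iff₀' hf', norm_le_iff _ (mul_pos hf' hk0)]
  exact convL1_mem_modularBall H φ hk0 hf (partToL1_mem_modularBall g hk0 hk.le)

variable (φ) in
/-- The action of `L¹(G ⧸ H)` on an Orlicz space, extended by continuity from the integrable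
elements. -/
noncomputable def convOrlicz : Lp ℂ 1 m →L[ℂ] OrliczSpace φ m →L[ℂ] OrliczSpace φ m :=
  -- The Orlicz variable comes first in `convPart` because it is the one extended; `flip` restores
  -- the order. Density enters in `convOrlicz_coe`, which identifies the values on integrable
  -- elements.
  ((LinearMap.mkContinuous₂ (convPart H (φ := φ) (m := m)) 1 fun g f => by
    rw [one_mul]
    exact norm_convPart_le H g f).extend (integrablePart φ m).subtypeL).flip

theorem convOrlicz_coe (hφ : φ.Delta2 m) (f : Lp ℂ 1 m) (g : integrablePart φ m) :
    convOrlicz H φ f (g : OrliczSpace φ m) = convPart H g f := by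
  have hd : DenseRange (integrablePart φ m).subtypeL := by
    simpa [DenseRange] using dense_integrablePart hφ
  have h := ContinuousLinearMap.extend_eq (LinearMap.mkContinuous₂ (convPart H (φ := φ) (m := m)) 1
    fun g f => by
      rw [one_mul]
      exact norm_convPart_le H g f) hd isUniformEmbedding_subtype_val.isUniformInducing g
  exact congrArg (fun T => T f) h

theorem norm_convOrlicz_le (hφ : φ.Delta2 m) (f : Lp ℂ 1 m) (g : OrliczSpace φ m) :
    ‖convOrlicz H φ f g‖ ≤ ‖f‖ * ‖g‖ := by
  refine (dense_integrablePart hφ).induction (P := fun g => ‖convOrlicz H φ f g‖ ≤ ‖f‖ * ‖g‖)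
    (fun g hg => ?_) (isClosed_le (by fun_prop) (by fun_prop)) g
  rw [convOrlicz_coe H hφ f ⟨g, hg⟩, mul_comm]
  exact norm_convPart_le H ⟨g, hg⟩ f

theorem convOrlicz_convL1 (hφ : φ.Delta2 m) (f f' : Lp ℂ 1 m) (g : OrliczSpace φ m) :
    convOrlicz H φ (convL1 H f f') g = convOrlicz H φ f (convOrlicz H φ f' g) := by
  refine (dense_integrablePart hφ).induction
    (P := fun g => convOrlicz H φ (convL1 H f f') g = convOrlicz H φ f (convOrlicz H φ f' g))
    (fun g hg => ?_) (isClosed_eq (by fun_prop) (by fun_prop)) g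
  -- Convolving an integrable element gives an integrable one, so on the dense subspace the module
  -- law is associativity in `L¹`.
  have hmem : convPart H ⟨g, hg⟩ f' ∈ integrablePart φ m :=
    (convL1 H f' (partToL1 ⟨g, hg⟩)).2
  rw [convOrlicz_coe H hφ _ ⟨g, hg⟩, convOrlicz_coe H hφ _ ⟨g, hg⟩,
    convOrlicz_coe H hφ _ ⟨_, hmem⟩]
  exact Subtype.ext (congrArg (fun u : Lp ℂ 1 m => (u : (G ⧸ H) →ₘ[m] ℂ))
    (convL1_assoc H f f' (partToL1 ⟨g, hg⟩)))

theorem convOrlicz_ccToOrlicz (hφ : φ.Delta2 m) (f g : C_c(G ⧸ H, ℂ)) :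
    convOrlicz H φ (ccToL1 m f) (ccToOrlicz φ m g) = ccToOrlicz φ m (convCc H m f g) := by
  -- The embeddings of `C_c` into `L¹` and `L^φ` have the same underlying class, so the claim
  -- reduces to `convL1_ccToL1`.
  have hmem : ccToOrlicz φ m g ∈ integrablePart φ m := (ccToL1 m g).2
  rw [convOrlicz_coe H hφ _ ⟨_, hmem⟩]
  exact Subtype.ext (congrArg (fun u : Lp ℂ 1 m => (u : (G ⧸ H) →ₘ[m] ℂ))
    (convL1_ccToL1 H f g))

end CosetConvolution

theorem theorem3p6 {G : Type*} [Group G] [TopologicalSpace G] [IsTopologicalGroup G]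
    [LocallyCompactSpace G] [T2Space G] [MeasurableSpace G] [BorelSpace G]
    (H : Subgroup G) [CompactSpace H]
    [MeasurableSpace (G ⧸ H)] [BorelSpace (G ⧸ H)]
    (μ : Measure G) [μ.IsHaarMeasure] [μ.Regular]
    (m : Measure (G ⧸ H)) [m.Regular] (hm : IsNormalizedInvariant H μ m)
    (φ : YoungFunction) (hφ : φ.Delta2 m) :
    ∃ conv : C_c(G ⧸ H, ℂ) →ₗ[ℂ] C_c(G ⧸ H, ℂ) →ₗ[ℂ] C_c(G ⧸ H, ℂ),
      (∀ (f g : C_c(G ⧸ H, ℂ)) (z : G ⧸ H), conv f g z = cosetConv H m f g z) ∧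
      ∃ (mul : Lp ℂ 1 m →ₗ[ℂ] Lp ℂ 1 m →ₗ[ℂ] Lp ℂ 1 m)
        (act : Lp ℂ 1 m →ₗ[ℂ] OrliczSpace φ m →ₗ[ℂ] OrliczSpace φ m),
        (∀ f g : C_c(G ⧸ H, ℂ), mul (ccToL1 m f) (ccToL1 m g) = ccToL1 m (conv f g)) ∧
        (∀ f g : C_c(G ⧸ H, ℂ),
          act (ccToL1 m f) (ccToOrlicz φ m g) = ccToOrlicz φ m (conv f g)) ∧
        IsBanachLeftModule mul act := by
  have := hm.invariant
  refine ⟨CosetConvolution.convCc H m, CosetConvolution.convCc_apply H m,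
    CosetConvolution.convL1 H, (CosetConvolution.convOrlicz H φ).toLinearMap₁₂,
    CosetConvolution.convL1_ccToL1 H, CosetConvolution.convOrlicz_ccToOrlicz H hφ,
    CosetConvolution.isBanachAlgebraProduct_convL1 H m, inferInstance,
    CosetConvolution.convOrlicz_convL1 H hφ, fun f g => ?_⟩
  rw [ContinuousLinearMap.toLinearMap₁₂_apply_apply_apply]
  exact CosetConvolution.norm_convOrlicz_le H hφ f g
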